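/- **Theorem 1.** Let $H\in(\tfrac12,1)$, $T>0$, $x_0\in\mathbb R$, and let $a,b,\sigma$ be measurable real functions with $\sigma>0$ on $[0,\infty)$. Let $(W^{H,j})_{j\ge1}$ be independent normalized fractional Brownian motions with Hurst index $H$ (centered Gaussian processes with $\mathbb E(W^{H}_tW^{H}_s)=\frac12(t^{2H}+s^{2H}-|t-s|^{2H})$), and let $(\phi_j)_{j\ge1}$ be i.i.d. real random variables, independent of $(W^{H,j})_{j\ge1}$, with a common density $f$ supported on $[0,1]$. For each $j$ let $X^j$ be a continuous solution of $$dX^j_t=\bigl(a(X^j_t)+\phi_j\,b(t)\bigr)dt+\sigma(t)\,dW^{H,j}_t,\qquad X^j_0=x_0 .$$ Put $$k_H(t,s)=\kappa_H^{-1}s^{\frac12-H}(t-s)^{\frac12-H}\mathbf 1_{(0,t)}(s),\quad \kappa_H=2H\,\Gamma(\tfrac32-H)\Gamma(H+\tfrac12),$$ $$w^H_t=\lambda_H^{-1}t^{2-2H},\quad \lambda_H=\frac{2H\,\Gamma(3-2H)\Gamma(H+\frac12)}{\Gamma(\frac32-H)},$$ $$J_1^j(t)=\frac{d}{dw^H_t}\int_0^tk_H(t,s)\frac{a(X^j_s)}{\sigma(s)}ds,\qquad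 J_2(t)=\frac{d}{dw^H_t}\int_0^tk_H(t,s)\frac{b(s)}{\sigma(s)}ds,\qquad Z^j_t=\int_0^t\frac{k_H(t,s)}{\sigma(s)}dX^j_s .$$ Assume that these derivatives are well defined (almost surely, for $J_1^j$), in the sense that the integrals $\int_0^t k_H(t,s)c(s)\,ds$ with $c=a(X^j)/\sigma$ and $c=b/\sigma$ exist for every $t>0$ and are absolutely continuous functions of $t$ on every bounded interval $[0,S]$, and that almost surely $\int_0^S J_1^j(t)^2dw^H_t<\infty$ for all $S>0$. Here integrals of deterministic functions against $W^{H,j}$ are Wiener integrals, $\int_0^t h\,dX^j=\int_0^t h(s)(a(X^j_s)+\phi_jb(s))ds+\int_0^t h(s)\sigma(s)dW^{H,j}_s$, and $\int_0^TJ_2\,dZ^j$ is the stochastic integral against the semimartingale $Z^j$, i.e. the limit in probability of the elementary integrals of step functions converging to $J_2$ in $L^2([0,T],dw^H)$. Let $$\hat\phi_{j,T}=\frac{\int_0^TJ_2(t)\,dZ^j_t-\int_0^TJ_1^j(t)J_2(t)\,dw^H_t}{\int_0^TJ_2(t)^2\,dw^H_t},\qquad \hat F_n(y)=\frac1n\sum_{j=1}^n\mathbf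 1_{\{\hat\phi_{j,T}\le y\}},$$ $$\hat f_{m,n}(x)=m\sum_{k=0}^{m-1}\Bigl[\hat F_n\bigl(\tfrac{k+1}m\bigr)-\hat F_n\bigl(\tfrac km\bigr)\Bigr]p_k(m-1,x),\qquad p_k(m,x)=\binom mk x^k(1-x)^{m-k}.$$ Fix $x\in[0,1]$ and assume: * (A1) $\int_0^SJ_2(t)^2dw^H_t<\infty$ for every $S>0$; * (A2) $\lim_{S\to\infty}\int_0^SJ_2(t)^2dw^H_t=\infty$; * (A3) $f$ is twice continuously differentiable on $[0,1]$; * (A4) $\hat\phi_{1,T}$ has a positive density $g$ on $\mathbb R$ that is continuous at $x$. Let $m=m_n$ be positive integers with $m_n\to\infty$ and $m_n/n\to0$ as $n\to\infty$ ($T$ is fixed). Then, as $n\to\infty$, with $\psi(x)=(4\pi x(1-x))^{-1/2}$: 1. if $x\in(0,1)$, then $n^{1/2}m^{-1/4}\bigl[\hat f_{m,n}(x)-\mathbb E\hat f_{m,n}(x)\bigr]$ converges in law to $\mathcal N\bigl(0,g(x)\psi(x)\bigr)$; 2. if $x\in\{0,1\}$, then $n^{1/2}m^{-1/2}\bigl[\hat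 f_{m,n}(x)-\mathbb E\hat f_{m,n}(x)\bigr]$ converges in law to $\mathcal N\bigl(0,g(x)\bigr)$. -/

import Mathlib

open MeasureTheory ProbabilityTheory Filter Set
open scoped Topology NNReal ENNReal

/-!
Stochastic processes are functions `Y : ℝ → Ω → ℝ` of a real time variable; only the times
`t ≥ 0` are ever used.
-/

namespace FracRE

noncomputable section

variable {Ω : Type*} [MeasurableSpace Ω]

/-- Normalized fractional Brownian motion `(W t)_{t ≥ 0}` with Hurst index `H`: a centered Gaussian
process with covariance `(t^{2H} + s^{2H} - |t - s|^{2H}) / 2`. -/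
structure IsFBM (P : Measure Ω) (H : ℝ) (W : ℝ → Ω → ℝ) : Prop where
  measurable : ∀ t, 0 ≤ t → Measurable (W t)
  gaussian : IsGaussianProcess (fun t : ℝ≥0 => W t) P
  centered : ∀ t, 0 ≤ t → ∫ ω, W t ω ∂P = 0
  covariance : ∀ s t, 0 ≤ s → 0 ≤ t →
    ∫ ω, W t ω * W s ω ∂P = (t ^ (2 * H) + s ^ (2 * H) - |t - s| ^ (2 * H)) / 2

/-! ### Integrals of deterministic functions against processes -/

/-- A step function `∑ i, coef i • 1_{(left i, right i]}` on `(0, t]`. -/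
structure StepFun (t : ℝ) where
  card : ℕ
  left : Fin card → ℝ
  right : Fin card → ℝ
  coef : Fin card → ℝ
  nonneg : ∀ i, 0 ≤ left i
  le : ∀ i, left i ≤ right i
  le_end : ∀ i, right i ≤ t

/-- The underlying function of a step function. -/
def StepFun.toFun {t : ℝ} (s : StepFun t) (u : ℝ) : ℝ :=
  ∑ i, (Ioc (s.left i) (s.right i)).indicator (fun _ => s.coef i) u

/-- The elementary integral of a step function against a path `y`. -/
def StepFun.integral {t : ℝ} (s : StepFun t) (y : ℝ → ℝ) : ℝ :=
  ∑ i, s.coef i * (y (s.right i) - y (s.left i))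

/-- `I` is the integral `∫_0^t h dY`, obtained by extending the elementary integral of step
functions continuously from the (pseudo-)norm `N` on integrands to convergence in probability:
`h` lies in the `N`-closure of the step functions on `(0, t]`, and the elementary integrals of
step functions converging to `h` for `N` converge to `I` in probability. -/
def IsExtendedIntegral (P : Measure Ω) (N : (ℝ → ℝ) → ℝ≥0∞) (Y : ℝ → Ω → ℝ) (h : ℝ → ℝ) (t : ℝ)
    (I : Ω → ℝ) : Prop :=
  (∃ s : ℕ → StepFun t, Tendsto (fun n => N (fun u => h u - (s n).toFun u)) atTop (𝓝 0)) ∧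
  ∀ s : ℕ → StepFun t, Tendsto (fun n => N (fun u => h u - (s n).toFun u)) atTop (𝓝 0) →
    TendstoInMeasure P (fun n ω => (s n).integral (fun u => Y u ω)) atTop I

/-- The (squared) norm `H (2H - 1) ∫_0^t ∫_0^t |h u| |h v| |u - v|^{2H - 2} du dv` of the usual
space of deterministic integrands for fractional Brownian motion with `H > 1/2`. -/
def fbmNormSq (H t : ℝ) (h : ℝ → ℝ) : ℝ≥0∞ :=
  ∫⁻ u in Ioc 0 t, ∫⁻ v in Ioc 0 t,
    ENNReal.ofReal (H * (2 * H - 1) * |h u| * |h v| * |u - v| ^ (2 * H - 2))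

/-- `I` is the Wiener integral `∫_0^t h dW` of the deterministic function `h` with respect to the
fractional Brownian motion `W` with Hurst index `H`. -/
def IsWienerIntegral (P : Measure Ω) (H : ℝ) (W : ℝ → Ω → ℝ) (h : ℝ → ℝ) (t : ℝ) (I : Ω → ℝ) :
    Prop :=
  IsExtendedIntegral P (fbmNormSq H t) W h t I

/-- `X` is a solution of `dX_t = (a(X_t) + φ b(t)) dt + σ(t) dW_t`, `X_0 = x₀`. -/
structure IsSolution (P : Measure Ω) (H : ℝ) (a b σ : ℝ → ℝ) (x₀ : ℝ) (φ : Ω → ℝ)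
    (W X : ℝ → Ω → ℝ) : Prop where
  measurable : ∀ t, 0 ≤ t → Measurable (X t)
  continuous : ∀ᵐ ω ∂P, ContinuousOn (fun t => X t ω) (Ici 0)
  initial : ∀ᵐ ω ∂P, X 0 ω = x₀
  integrable : ∀ᵐ ω ∂P, ∀ t, 0 < t →
    IntegrableOn (fun s => a (X s ω) + φ ω * b s) (Ioc 0 t)
  equation : ∀ t, 0 ≤ t → IsWienerIntegral P H W σ t
    (fun ω => X t ω - x₀ - ∫ s in Ioc 0 t, (a (X s ω) + φ ω * b s))

/-- For `X` with stochastic differential `dX_s = (a(X_s) + φ b(s)) ds + σ(s) dW_s`, the random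
variable `I` is the integral
`∫_0^t h(s) dX_s = ∫_0^t h(s) (a(X_s) + φ b(s)) ds + ∫_0^t h(s) σ(s) dW_s`. -/
def IsDiffusionIntegral (P : Measure Ω) (H : ℝ) (a b σ : ℝ → ℝ) (φ : Ω → ℝ) (W X : ℝ → Ω → ℝ)
    (h : ℝ → ℝ) (t : ℝ) (I : Ω → ℝ) : Prop :=
  (∀ᵐ ω ∂P, IntegrableOn (fun s => h s * (a (X s ω) + φ ω * b s)) (Ioc 0 t)) ∧
  IsWienerIntegral P H W (fun s => h s * σ s) t
    (fun ω => I ω - ∫ s in Ioc 0 t, h s * (a (X s ω) + φ ω * b s))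

/-! ### The kernel `k_H`, the function `w^H` and the functions `J_1`, `J_2` -/

/-- `κ_H = 2H Γ(3/2 - H) Γ(H + 1/2)`. -/
def kappa (H : ℝ) : ℝ := 2 * H * Real.Gamma (3 / 2 - H) * Real.Gamma (H + 1 / 2)

/-- `k_H(t, s) = κ_H⁻¹ s^{1/2 - H} (t - s)^{1/2 - H} 1_{(0,t)}(s)`. -/
def kernel (H t s : ℝ) : ℝ :=
  (Ioo 0 t).indicator
    (fun s => (kappa H)⁻¹ * s ^ (1 / 2 - H) * (t - s) ^ (1 / 2 - H)) s

/-- `λ_H = 2H Γ(3 - 2H) Γ(H + 1/2) / Γ(3/2 - H)`. -/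
def lam (H : ℝ) : ℝ :=
  2 * H * Real.Gamma (3 - 2 * H) * Real.Gamma (H + 1 / 2) / Real.Gamma (3 / 2 - H)

/-- `w^H_t = λ_H⁻¹ t^{2 - 2H}`. -/
def w (H t : ℝ) : ℝ := (lam H)⁻¹ * t ^ (2 - 2 * H)

/-- The measure `dw^H_t` on `(0, ∞)`, that is `(w^H)'(t) dt`. -/
def dw (H : ℝ) : Measure ℝ :=
  (volume.restrict (Ioi 0)).withDensity (fun t => ENNReal.ofReal (deriv (w H) t))

/-- `t ↦ ∫_0^t k_H(t, s) c(s) ds`. -/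
def kernelInt (H : ℝ) (c : ℝ → ℝ) (t : ℝ) : ℝ := ∫ s in Ioc 0 t, kernel H t s * c s

/-- The derivative `d/dw^H_t ∫_0^t k_H(t, s) c(s) ds`. This is `J_2` for `c = b / σ` and `J_1^j` for
`c = a(X^j) / σ`. -/
def J (H : ℝ) (c : ℝ → ℝ) (t : ℝ) : ℝ := deriv (kernelInt H c) t / deriv (w H) t

/-- `c` is such that the derivative `J H c` is well defined: the integrals `∫_0^t k_H(t, s) c(s) ds`
exist and form an absolutely continuous function of `t` on every `[0, T]`. -/
def HasJ (H : ℝ) (c : ℝ → ℝ) : Prop :=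
  (∀ t, 0 < t → IntegrableOn (fun s => kernel H t s * c s) (Ioc 0 t)) ∧
  ∀ T, 0 < T → AbsolutelyContinuousOnInterval (kernelInt H c) 0 T

/-- `J_2(t) = d/dw^H_t ∫_0^t k_H(t, s) b(s) / σ(s) ds`. -/
def J₂ (H : ℝ) (b σ : ℝ → ℝ) : ℝ → ℝ := J H (fun s => b s / σ s)

/-- `J_1(t) = d/dw^H_t ∫_0^t k_H(t, s) a(x(s)) / σ(s) ds` along the path `x`. -/
def J₁ (H : ℝ) (a σ x : ℝ → ℝ) : ℝ → ℝ := J H (fun s => a (x s) / σ s)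

/-- `I` is the stochastic integral `∫_0^T h dZ` of a deterministic `h ∈ L²([0,T], dw^H)` with
respect to a semimartingale `Z` with quadratic variation `w^H`. -/
def IsSemimartingaleIntegral (P : Measure Ω) (H : ℝ) (Z : ℝ → Ω → ℝ) (h : ℝ → ℝ) (T : ℝ)
    (I : Ω → ℝ) : Prop :=
  IsExtendedIntegral P (fun h => eLpNorm h 2 ((dw H).restrict (Ioc 0 T))) Z h T I

/-! ### The estimators -/

/-- The maximum likelihood estimator of a random effect,
`(∫_0^T J_2 dZ - ∫_0^T J_1 J_2 dw^H) / ∫_0^T J_2² dw^H`, from the path `x` observed on `[0, T]` and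
the value `I` of `∫_0^T J_2 dZ`. -/
def phiHat (H : ℝ) (a b σ : ℝ → ℝ) (T : ℝ) (x : ℝ → ℝ) (I : ℝ) : ℝ :=
  (I - ∫ t in Ioc 0 T, J₁ H a σ x t * J₂ H b σ t ∂(dw H)) /
    ∫ t in Ioc 0 T, J₂ H b σ t ^ 2 ∂(dw H)

/-- Empirical distribution function of the first `n` terms of the sample `y`. -/
def empCDF (y : ℕ → ℝ) (n : ℕ) (u : ℝ) : ℝ :=
  (1 / (n : ℝ)) * ∑ j ∈ Finset.range n, (Iic u).indicator (fun _ => (1 : ℝ)) (y j)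

/-- Bernstein density estimator of order `m` from the first `n` terms of the sample `y`. -/
def bernsteinEstimator (y : ℕ → ℝ) (m n : ℕ) (x : ℝ) : ℝ :=
  m * ∑ k ∈ Finset.range m,
    (empCDF y n (((k : ℝ) + 1) / m) - empCDF y n ((k : ℝ) / m)) *
      (bernsteinPolynomial ℝ (m - 1) k).eval x

/-- `ψ(x) = (4 π x (1 - x))^{-1/2}`. -/
def psi (x : ℝ) : ℝ := (4 * Real.pi * x * (1 - x)) ^ (-(1 / 2) : ℝ)

/-- `h` is a probability density of the real random variable `Y`. -/
def IsDensity (P : Measure Ω) (Y : Ω → ℝ) (h : ℝ → ℝ) : Prop :=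
  AEMeasurable Y P ∧ Measurable h ∧ (∀ y, 0 ≤ h y) ∧
    P.map Y = volume.withDensity (fun y => ENNReal.ofReal (h y))

end

end FracRE

/-! The equation is linear in the random effect. Removing the drift from `Z j t` leaves the Wiener
integral `M j t` of the kernel `k_H(t, ·)` against `W j`, and the drift part is `kernelInt` of
`a(X)/σ` plus `φ j` times `kernelInt` of `b/σ`. Integrating `J₂` against these primitives gives `∫
J₁ J₂ dw` and `φ j · c` with `c = ∫ J₂² dw`. So the estimator is `(φ j · c + ∫ J₂ dM)/c`, where `∫
J₂ dM` is a limit in probability of elementary integrals of the noise. Since all `W j` have one law,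
this limit is one measurable functional of the path for every `j` (`exists_measurable_phiHat`), and
the estimators are i.i.d. (`phiHat_iid`).

What remains concerns an i.i.d. sample with a density `g` continuous at `x`. The Bernstein estimator
is the average of `bernsteinKernel m x (Y j)`. The cells are disjoint, so the squared kernel has
mean `m² ∑ p_k² μ(cell k)`. The binomial weights concentrate near `x`, where a cell has mass about
`g(x)/m`, so this mean is about `m g(x) ∑ p_k²`, while the mean of the kernel stays bounded.

The sum `∑ p_k²` is the probability that two independent binomial variables coincide: asymptotically
`ψ(x)/√m` inside `(0,1)` by Parseval and a Laplace-type limit (`tendsto_sqrt_mul_sum_sq_bernstein`),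
and exactly `1` at the endpoints. This accounts for the two normalizations. Since `m/n → 0`, the
scaled summands are uniformly small, and a triangular central limit theorem
(`tendstoInDistribution_triangular`) concludes. -/

namespace FracRE

/-! ### Laws of the driving noises and independence of pairs -/

/-- Two real Gaussian processes with the same mean and covariance functions have the same law. -/
theorem map_eq_of_isGaussianProcess {Ω T : Type*} [MeasurableSpace Ω] {P : Measure Ω}
    [IsProbabilityMeasure P] {X Y : T → Ω → ℝ} (hX : IsGaussianProcess X P)
    (hY : IsGaussianProcess Y P) (hXm : ∀ t, Measurable (X t)) (hYm : ∀ t, Measurable (Y t))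
    (hmean : ∀ t, P[X t] = P[Y t]) (hcov : ∀ s t, cov[X s, X t; P] = cov[Y s, Y t; P]) :
    P.map (fun ω t => X t ω) = P.map (fun ω t => Y t ω) := by
  rw [map_eq_iff_forall_finset_map_restrict_eq (measurable_pi_lambda _ hXm).aemeasurable
    (measurable_pi_lambda _ hYm).aemeasurable]
  intro I
  have hXI : Measurable (fun ω => I.restrict (X · ω)) := measurable_pi_lambda _ fun _ => hXm _
  have hYI : Measurable (fun ω => I.restrict (Y · ω)) := measurable_pi_lambda _ fun _ => hYm _
  -- Gaussian measures on a Hilbert space are determined by mean and covariance form, so the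
  -- finite-dimensional laws are moved to Euclidean space.
  apply (MeasurableEquiv.toLp 2 (_ → ℝ)).map_measurableEquiv_injective
  rw [MeasurableEquiv.coe_toLp, ← PiLp.coe_symm_continuousLinearEquiv 2 ℝ]
  have := (hX.hasGaussianLaw I).isGaussian_map
  have := (hY.hasGaussianLaw I).isGaussian_map
  apply IsGaussian.ext
  · rw [integral_map, integral_map, integral_map, integral_map]
    · simp only [id_eq]
      rw [ContinuousLinearEquiv.integral_comp_comm, ContinuousLinearEquiv.integral_comp_comm]
      congr 1
      ext i
      rw [eval_integral, eval_integral]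
      · exact hmean _
      · exact fun _ => (hY.hasGaussianLaw_eval _).integrable
      · exact fun _ => (hX.hasGaussianLaw_eval _).integrable
    any_goals fun_prop
    · exact hYI.aemeasurable
    · exact hXI.aemeasurable
  · rw [← ContinuousLinearMap.toBilinForm_inj]
    refine LinearMap.BilinForm.ext_of_isSymm isPosSemidef_covarianceBilin.isSymm
      isPosSemidef_covarianceBilin.isSymm fun x => ?_
    simp only [ContinuousLinearMap.toBilinForm_apply]
    rw [PiLp.coe_symm_continuousLinearEquiv, covarianceBilin_apply_pi, covarianceBilin_apply_pi]
    · congrm ∑ i, ∑ j, _ * ?_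
      rw [covariance_map, covariance_map]
      · exact hcov _ _
      any_goals exact Measurable.aestronglyMeasurable (by fun_prop)
      · exact hYI.aemeasurable
      · exact hXI.aemeasurable
    · exact fun i => ((hY.hasGaussianLaw I).isGaussian_map.hasGaussianLaw_id.eval i).memLp_two
    · exact fun i => ((hX.hasGaussianLaw I).isGaussian_map.hasGaussianLaw_id.eval i).memLp_two

theorem IsFBM.measurable_path {Ω : Type*} [MeasurableSpace Ω] {P : Measure Ω} {H : ℝ}
    {W : ℝ → Ω → ℝ} (hW : IsFBM P H W) : Measurable (fun ω (t : ℝ≥0) => W t ω) :=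
  measurable_pi_lambda _ fun t => hW.measurable t t.2

/-- Fractional Brownian motions with the same Hurst index have the same law. -/
theorem IsFBM.map_eq {Ω : Type*} [MeasurableSpace Ω] {P : Measure Ω} [IsProbabilityMeasure P]
    {H : ℝ} {W W' : ℝ → Ω → ℝ} (hW : IsFBM P H W) (hW' : IsFBM P H W') :
    P.map (fun ω (t : ℝ≥0) => W t ω) = P.map (fun ω (t : ℝ≥0) => W' t ω) := by
  refine map_eq_of_isGaussianProcess (X := fun t : ℝ≥0 => W t) (Y := fun t : ℝ≥0 => W' t)
    hW.gaussian hW'.gaussian (fun t => hW.measurable t t.2) (fun t => hW'.measurable t t.2)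
    (fun t => ?_) fun s t => ?_
  · rw [hW.centered t t.2, hW'.centered t t.2]
  · rw [covariance_eq_sub (hW.gaussian.hasGaussianLaw_eval s).memLp_two
      (hW.gaussian.hasGaussianLaw_eval t).memLp_two,
      covariance_eq_sub (hW'.gaussian.hasGaussianLaw_eval s).memLp_two
      (hW'.gaussian.hasGaussianLaw_eval t).memLp_two, hW.centered s s.2, hW'.centered s s.2]
    simp only [Pi.mul_apply, zero_mul, sub_zero]
    rw [hW.covariance t s t.2 s.2, hW'.covariance t s t.2 s.2]

/-- If `U` and `V` are independent sequences of independent random variables, then the pairs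
`(U j, V j)` are independent. -/
theorem iIndepFun_prodMk_of_indepFun {Ω ι 𝓤 𝓥 : Type*} [MeasurableSpace Ω] [MeasurableSpace 𝓤]
    [MeasurableSpace 𝓥] {P : Measure Ω} [IsProbabilityMeasure P] {U : ι → Ω → 𝓤} {V : ι → Ω → 𝓥}
    (hU : ∀ j, Measurable (U j)) (hV : ∀ j, Measurable (V j)) (hUi : iIndepFun U P)
    (hVi : iIndepFun V P) (hUV : IndepFun (fun ω j => U j ω) (fun ω j => V j ω) P) :
    iIndepFun (fun j ω => (U j ω, V j ω)) P := by
  classical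
  have hpair : ∀ j, IndepFun (U j) (V j) P := fun j =>
    hUV.comp (measurable_pi_apply j) (measurable_pi_apply j)
  -- Rectangles form a π-system generating the σ-algebra of the pair; independence need only be
  -- tested on them.
  let π : ι → Set (Set Ω) := fun j =>
    {s | ∃ A B, MeasurableSet A ∧ MeasurableSet B ∧ s = U j ⁻¹' A ∩ V j ⁻¹' B}
  refine iIndepSets.iIndep (fun j => ((hU j).prodMk (hV j)).comap_le) π ?_ ?_ ?_
  · rintro j _ ⟨A, B, hA, hB, rfl⟩ _ ⟨A', B', hA', hB', rfl⟩ -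
    refine ⟨A ∩ A', B ∩ B', hA.inter hA', hB.inter hB', ?_⟩
    ext; simp; tauto
  · intro j
    rw [← generateFrom_prod, MeasurableSpace.comap_generateFrom]
    congr 1
    ext s
    simp only [mem_image, mem_image2, mem_ofPred_eq, π]
    constructor
    · rintro ⟨_, ⟨A, hA, B, hB, rfl⟩, rfl⟩
      exact ⟨A, B, hA, hB, by ext; simp⟩
    · rintro ⟨A, B, hA, hB, rfl⟩
      exact ⟨_, ⟨A, hA, B, hB, rfl⟩, by ext; simp⟩
  · rw [iIndepSets_iff]
    intro s f hf
    choose! A B hA hB hAB using hf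
    have h1 : (⋂ i ∈ s, f i) = (fun ω j => U j ω) ⁻¹' (⋂ i ∈ s, (fun u => u i) ⁻¹' A i) ∩
        (fun ω j => V j ω) ⁻¹' (⋂ i ∈ s, (fun u => u i) ⁻¹' B i) := by
      ext ω
      simp only [mem_iInter, mem_inter_iff, mem_preimage]
      constructor
      · intro h
        refine ⟨fun i hi => ?_, fun i hi => ?_⟩
        · have := h i hi; rw [hAB i hi] at this; exact this.1
        · have := h i hi; rw [hAB i hi] at this; exact this.2
      · intro h i hi
        rw [hAB i hi]; exact ⟨h.1 i hi, h.2 i hi⟩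
    rw [h1, hUV.measure_inter_preimage_eq_mul _ _
      (s.measurableSet_biInter fun i hi => measurable_pi_apply i (hA i hi))
      (s.measurableSet_biInter fun i hi => measurable_pi_apply i (hB i hi))]
    have h2 : (fun ω j => U j ω) ⁻¹' (⋂ i ∈ s, (fun u => u i) ⁻¹' A i) = ⋂ i ∈ s, U i ⁻¹' A i := by
      ext; simp
    have h3 : (fun ω j => V j ω) ⁻¹' (⋂ i ∈ s, (fun u => u i) ⁻¹' B i) = ⋂ i ∈ s, V i ⁻¹' B i := by
      ext; simp
    rw [h2, h3, hUi.measure_inter_preimage_eq_mul s hA, hVi.measure_inter_preimage_eq_mul s hB,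
      ← Finset.prod_mul_distrib]
    refine Finset.prod_congr rfl fun i hi => ?_
    rw [hAB i hi, (hpair i).measure_inter_preimage_eq_mul _ _ (hA i hi) (hB i hi)]

/-! ### Limits of functionals of identically distributed elements -/

/-- Suppose that for each of the identically distributed random elements `V j`, every subsequence of
the functionals `E n` of `V j` has a further subsequence converging to `L j` almost surely. Then all
`L j` are almost surely given by one measurable functional. -/
theorem exists_measurable_ae_eq_comp {Ω 𝓢 : Type*} [MeasurableSpace Ω]
    [MeasurableSpace 𝓢] {P : Measure Ω} {V : ℕ → Ω → 𝓢}
    (hV : ∀ j, Measurable (V j)) (hlaw : ∀ j, P.map (V j) = P.map (V 0)) {E : ℕ → 𝓢 → ℝ}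
    (hE : ∀ n, Measurable (E n)) {L : ℕ → Ω → ℝ}
    (hL : ∀ j, ∀ ns : ℕ → ℕ, StrictMono ns → ∃ ms : ℕ → ℕ, StrictMono ms ∧
      ∀ᵐ ω ∂P, Tendsto (fun i => E (ns (ms i)) (V j ω)) atTop (𝓝 (L j ω))) :
    ∃ Φ : 𝓢 → ℝ, Measurable Φ ∧ ∀ j, L j =ᵐ[P] Φ ∘ V j := by
  obtain ⟨ns, hns, hae⟩ := hL 0 id strictMono_id
  let A : Set 𝓢 := {v | ∃ l, Tendsto (fun i => E (ns i) v) atTop (𝓝 l)}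
  have hA : MeasurableSet A := measurableSet_exists_tendsto fun i => hE (ns i)
  have hA0 : ∀ᵐ v ∂(P.map (V 0)), v ∈ A := by
    refine (ae_map_iff (hV 0).aemeasurable hA).2 ?_
    filter_upwards [hae] with ω hω using ⟨_, hω⟩
  obtain ⟨Φ, hΦ, hΦlim⟩ := measurable_limit_of_tendsto_metrizable_ae
    (μ := P.map (V 0)) (L := atTop) (f := fun i => E (ns i)) (fun i => (hE (ns i)).aemeasurable) hA0
  refine ⟨Φ, hΦ, fun j => ?_⟩
  -- Convergence to `Φ` on a set of full measure depends only on the law, so it passes from `V 0` to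
  -- `V j`.
  have hj : ∀ᵐ ω ∂P, Tendsto (fun i => E (ns i) (V j ω)) atTop (𝓝 (Φ (V j ω))) :=
    ae_of_ae_map (hV j).aemeasurable (by rw [hlaw j]; exact hΦlim)
  -- Extracting again from the subsequence `ns` already chosen for `V 0` lets the two limits be
  -- compared.
  obtain ⟨ms, hms, hlim⟩ := hL j ns hns
  filter_upwards [hj, hlim] with ω h1 h2
  exact tendsto_nhds_unique h2 (h1.comp hms.tendsto_atTop)

/-! ### The measure `dw` and the derivatives `J` -/

theorem lam_pos {H : ℝ} (hH : H ∈ Ioo (1 / 2 : ℝ) 1) : 0 < lam H := by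
  obtain ⟨h1, h2⟩ := hH
  have := Real.Gamma_pos_of_pos (show 0 < 3 - 2 * H by linarith)
  have := Real.Gamma_pos_of_pos (show 0 < H + 1 / 2 by linarith)
  have := Real.Gamma_pos_of_pos (show 0 < 3 / 2 - H by linarith)
  have : 0 < H := by linarith
  unfold lam
  positivity

theorem deriv_w_pos {H : ℝ} (hH : H ∈ Ioo (1 / 2 : ℝ) 1) {t : ℝ} (ht : 0 < t) :
    0 < deriv (w H) t := by
  have h : HasDerivAt (w H) ((lam H)⁻¹ * ((2 - 2 * H) * t ^ (2 - 2 * H - 1))) t :=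
    (Real.hasDerivAt_rpow_const (Or.inl ht.ne')).const_mul _
  rw [h.deriv]
  have := lam_pos hH
  have : 0 < 2 - 2 * H := by linarith [hH.2]
  positivity

theorem restrict_dw (H S : ℝ) : (dw H).restrict (Ioc 0 S) =
    (volume.restrict (Ioc 0 S)).withDensity (fun t => ENNReal.ofReal (deriv (w H) t)) := by
  unfold dw
  rw [restrict_withDensity measurableSet_Ioc, Measure.restrict_restrict measurableSet_Ioc,
    inter_eq_left.2 fun t ht => ht.1]

theorem setIntegral_dw {H : ℝ} (hH : H ∈ Ioo (1 / 2 : ℝ) 1) (S : ℝ) (f : ℝ → ℝ) :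
    ∫ t in Ioc 0 S, f t ∂(dw H) = ∫ t in Ioc 0 S, deriv (w H) t * f t := by
  rw [restrict_dw, integral_withDensity_eq_integral_toReal_smul
    (measurable_deriv _).ennreal_ofReal (by simp)]
  refine setIntegral_congr_fun measurableSet_Ioc fun t ht => ?_
  simp [ENNReal.toReal_ofReal (deriv_w_pos hH ht.1).le]

theorem integrableOn_dw_iff {H : ℝ} (hH : H ∈ Ioo (1 / 2 : ℝ) 1) (S : ℝ) (f : ℝ → ℝ) :
    IntegrableOn f (Ioc 0 S) (dw H) ↔ IntegrableOn (fun t => deriv (w H) t * f t) (Ioc 0 S) := by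
  rw [IntegrableOn, restrict_dw, integrable_withDensity_iff_integrable_smul'
    (measurable_deriv _).ennreal_ofReal (by simp)]
  refine integrableOn_congr_fun (fun t ht => ?_) measurableSet_Ioc
  simp [ENNReal.toReal_ofReal (deriv_w_pos hH ht.1).le]

theorem measurable_J (H : ℝ) (c : ℝ → ℝ) : Measurable (J H c) :=
  (measurable_deriv _).div (measurable_deriv _)

theorem deriv_w_mul_J {H : ℝ} (hH : H ∈ Ioo (1 / 2 : ℝ) 1) (c : ℝ → ℝ) {t : ℝ} (ht : 0 < t) :
    deriv (w H) t * J H c t = deriv (kernelInt H c) t :=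
  mul_div_cancel₀ _ (deriv_w_pos hH ht).ne'

theorem HasJ.integrableOn {H : ℝ} (hH : H ∈ Ioo (1 / 2 : ℝ) 1) {c : ℝ → ℝ} (hc : HasJ H c) {T : ℝ}
    (hT : 0 < T) : IntegrableOn (J H c) (Ioc 0 T) (dw H) := by
  rw [integrableOn_dw_iff hH]
  have h := (hc.2 T hT).intervalIntegrable_deriv
  rw [intervalIntegrable_iff_integrableOn_Ioc_of_le hT.le] at h
  exact h.congr_fun (fun t ht => (deriv_w_mul_J hH c ht.1).symm) measurableSet_Ioc

/-- The increments of `kernelInt H c` are the integrals of `J H c` against `dw`. -/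
theorem HasJ.kernelInt_sub {H : ℝ} (hH : H ∈ Ioo (1 / 2 : ℝ) 1) {c : ℝ → ℝ} (hc : HasJ H c)
    {T l r : ℝ} (hT : 0 < T) (hl : 0 ≤ l) (hlr : l ≤ r) (hr : r ≤ T) :
    kernelInt H c r - kernelInt H c l =
      ∫ t in Ioc 0 T, (Ioc l r).indicator (fun _ => (1 : ℝ)) t * J H c t ∂(dw H) := by
  have hac : AbsolutelyContinuousOnInterval (kernelInt H c) l r :=
    (hc.2 T hT).mono (by
      rw [uIcc_of_le hlr, uIcc_of_le hT.le]; exact Icc_subset_Icc hl hr)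
  rw [← hac.integral_deriv_eq_sub, intervalIntegral.integral_of_le hlr, setIntegral_dw hH]
  have h1 : ∀ t ∈ Ioc 0 T, deriv (w H) t * ((Ioc l r).indicator (fun _ => (1 : ℝ)) t * J H c t) =
      (Ioc l r).indicator (deriv (kernelInt H c)) t := by
    intro t ht
    by_cases h : t ∈ Ioc l r
    · simp [h, deriv_w_mul_J hH c ht.1]
    · simp [h]
  rw [setIntegral_congr_fun measurableSet_Ioc h1, setIntegral_indicator measurableSet_Ioc,
    inter_eq_right.2 (Ioc_subset_Ioc hl hr)]

/-! ### Elementary integrals and their limits -/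

theorem StepFun.measurable_toFun {T : ℝ} (s : StepFun T) : Measurable s.toFun := by
  unfold StepFun.toFun
  exact Finset.measurable_sum _ fun i _ => measurable_const.indicator measurableSet_Ioc

theorem StepFun.abs_toFun_le {T : ℝ} (s : StepFun T) (u : ℝ) : |s.toFun u| ≤ ∑ i, |s.coef i| := by
  refine (Finset.abs_sum_le_sum_abs _ _).trans (Finset.sum_le_sum fun i _ => ?_)
  by_cases h : u ∈ Ioc (s.left i) (s.right i) <;> simp [h]

/-- Summing `HasJ.kernelInt_sub` over the steps turns an elementary integral along a path into a
pairing with `J H c`, which is continuous for the `L²(dw)` norm. -/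
theorem StepFun.integral_kernelInt {H : ℝ} (hH : H ∈ Ioo (1 / 2 : ℝ) 1) {c : ℝ → ℝ}
    (hc : HasJ H c) {T : ℝ} (hT : 0 < T) (s : StepFun T) :
    s.integral (kernelInt H c) = ∫ t in Ioc 0 T, s.toFun t * J H c t ∂(dw H) := by
  unfold StepFun.integral StepFun.toFun
  simp_rw [Finset.sum_mul]
  have hint := hc.integrableOn hH hT
  rw [integral_finsetSum]
  · refine Finset.sum_congr rfl fun i _ => ?_
    rw [hc.kernelInt_sub hH hT (s.nonneg i) (s.le i) (s.le_end i), ← integral_const_mul]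
    congr 1
    ext t
    by_cases h : t ∈ Ioc (s.left i) (s.right i) <;> simp [h]
  · intro i _
    refine Integrable.bdd_mul (c := |s.coef i|) hint
      (measurable_const.indicator measurableSet_Ioc).aestronglyMeasurable
      (Eventually.of_forall fun t => ?_)
    by_cases h : t ∈ Ioc (s.left i) (s.right i) <;> simp [h]

/-- By the Cauchy–Schwarz inequality, `L²` convergence of `f n` gives `L¹` convergence of the
products with `u`. -/
theorem tendsto_integral_mul_of_eLpNorm_two {α : Type*} [MeasurableSpace α] {μ : Measure α}
    {u h : α → ℝ} {f : ℕ → α → ℝ} (hu : MemLp u 2 μ) (hh : MemLp h 2 μ)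
    (hf : ∀ n, AEStronglyMeasurable (f n) μ) (huf : ∀ n, Integrable (fun t => f n t * u t) μ)
    (hlim : Tendsto (fun n => eLpNorm (fun t => h t - f n t) 2 μ) atTop (𝓝 0)) :
    Tendsto (fun n => ∫ t, f n t * u t ∂μ) atTop (𝓝 (∫ t, u t * h t ∂μ)) := by
  have hint : Integrable (fun t => u t * h t) μ := hu.integrable_mul hh
  have key : ∀ n, eLpNorm (u • fun t => h t - f n t) 1 μ ≤
      eLpNorm u 2 μ * eLpNorm (fun t => h t - f n t) 2 μ := fun n =>
    eLpNorm_smul_le_mul_eLpNorm (hh.1.sub (hf n)) hu.1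
  have h0 : Tendsto (fun n => eLpNorm u 2 μ * eLpNorm (fun t => h t - f n t) 2 μ)
      atTop (𝓝 0) := by
    simpa using ENNReal.Tendsto.const_mul hlim (Or.inr hu.2.ne)
  refine tendsto_integral_of_L1 _ hint.1 (Eventually.of_forall huf) ?_
  refine tendsto_of_tendsto_of_tendsto_of_le_of_le tendsto_const_nhds h0 (fun _ => zero_le)
    fun n => le_trans (le_of_eq ?_) (key n)
  rw [eLpNorm_one_eq_lintegral_enorm]
  refine lintegral_congr fun t => ?_
  rw [← enorm_neg]
  congr 1
  simp only [Pi.smul_apply', smul_eq_mul]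
  ring

/-- Step functions converging to `h` in `L²(dw)` have elementary integrals against `kernelInt H c`
converging to the integral of `J H c * h`. -/
theorem tendsto_integral_kernelInt {H : ℝ} (hH : H ∈ Ioo (1 / 2 : ℝ) 1) {c : ℝ → ℝ}
    (hc : HasJ H c) {T : ℝ} (hT : 0 < T) (hc2 : IntegrableOn (fun t => J H c t ^ 2) (Ioc 0 T) (dw H))
    {h : ℝ → ℝ} (hh : Measurable h) (hh2 : IntegrableOn (fun t => h t ^ 2) (Ioc 0 T) (dw H))
    {s : ℕ → StepFun T} (hs : Tendsto (fun n => eLpNorm (fun u => h u - (s n).toFun u) 2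
      ((dw H).restrict (Ioc 0 T))) atTop (𝓝 0)) :
    Tendsto (fun n => (s n).integral (kernelInt H c)) atTop
      (𝓝 (∫ t in Ioc 0 T, J H c t * h t ∂(dw H))) := by
  simp_rw [fun n => (s n).integral_kernelInt hH hc hT]
  refine tendsto_integral_mul_of_eLpNorm_two
    ((memLp_two_iff_integrable_sq (measurable_J H c).aestronglyMeasurable).2 hc2)
    ((memLp_two_iff_integrable_sq hh.aestronglyMeasurable).2 hh2)
    (fun n => (s n).measurable_toFun.aestronglyMeasurable) (fun n => ?_) hs
  exact Integrable.bdd_mul (c := ∑ i, |(s n).coef i|) (hc.integrableOn hH hT)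
    (s n).measurable_toFun.aestronglyMeasurable (Eventually.of_forall fun t => (s n).abs_toFun_le t)

theorem StepFun.integral_add {T : ℝ} (s : StepFun T) (y z : ℝ → ℝ) :
    s.integral (fun u => y u + z u) = s.integral y + s.integral z := by
  simp only [StepFun.integral, ← Finset.sum_add_distrib]
  exact Finset.sum_congr rfl fun i _ => by ring

theorem StepFun.integral_const_mul {T : ℝ} (s : StepFun T) (r : ℝ) (y : ℝ → ℝ) :
    s.integral (fun u => r * y u) = r * s.integral y := by
  simp only [StepFun.integral, Finset.mul_sum]
  exact Finset.sum_congr rfl fun i _ => by ring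

theorem StepFun.integral_congr {T : ℝ} (s : StepFun T) {y z : ℝ → ℝ}
    (h : ∀ u ∈ Icc 0 T, y u = z u) : s.integral y = s.integral z :=
  Finset.sum_congr rfl fun i _ => by
    rw [h _ ⟨s.nonneg i, (s.le i).trans (s.le_end i)⟩,
      h _ ⟨(s.nonneg i).trans (s.le i), s.le_end i⟩]

theorem StepFun.measurable_integral {𝓢 : Type*} [MeasurableSpace 𝓢] {T : ℝ} (s : StepFun T)
    {Y : ℝ → 𝓢 → ℝ} (hY : ∀ u ∈ Icc 0 T, Measurable (Y u)) :
    Measurable (fun v => s.integral (fun u => Y u v)) := by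
  unfold StepFun.integral
  exact Finset.measurable_sum _ fun i _ => ((hY _ ⟨(s.nonneg i).trans (s.le i), s.le_end i⟩).sub
    (hY _ ⟨s.nonneg i, (s.le i).trans (s.le_end i)⟩)).const_mul _

/-- A step function reads the process at finitely many times only, so equality almost surely at each
fixed time is enough; no common null set for all times is needed. -/
theorem StepFun.ae_integral_eq {Ω : Type*} [MeasurableSpace Ω] {P : Measure Ω} {T : ℝ}
    (s : StepFun T) {Y Z : ℝ → Ω → ℝ} (h : ∀ u ∈ Icc 0 T, Y u =ᵐ[P] Z u) :
    ∀ᵐ ω ∂P, s.integral (fun u => Y u ω) = s.integral (fun u => Z u ω) := by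
  have h1 : ∀ᵐ ω ∂P, ∀ i, Y (s.right i) ω = Z (s.right i) ω :=
    ae_all_iff.2 fun i => h _ ⟨(s.nonneg i).trans (s.le i), s.le_end i⟩
  have h2 : ∀ᵐ ω ∂P, ∀ i, Y (s.left i) ω = Z (s.left i) ω :=
    ae_all_iff.2 fun i => h _ ⟨s.nonneg i, (s.le i).trans (s.le_end i)⟩
  filter_upwards [h1, h2] with ω h1 h2
  exact Finset.sum_congr rfl fun i _ => by simp only [h1, h2]

/-! ### The estimators as i.i.d. functionals of effect and noise -/

/-- The Wiener integrals of one function against several fractional Brownian motions are given by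
one measurable functional of the paths. -/
theorem exists_measurable_wienerIntegral {Ω : Type*} [MeasurableSpace Ω] {P : Measure Ω}
    [IsProbabilityMeasure P] {H : ℝ} {W : ℕ → ℝ → Ω → ℝ} (hW : ∀ j, IsFBM P H (W j)) {h : ℝ → ℝ}
    {t : ℝ} {M : ℕ → Ω → ℝ} (hM : ∀ j, IsWienerIntegral P H (W j) h t (M j)) :
    ∃ Φ : (ℝ≥0 → ℝ) → ℝ, Measurable Φ ∧ ∀ j, M j =ᵐ[P] fun ω => Φ (fun u : ℝ≥0 => W j u ω) := by
  -- The norm involves only the deterministic integrand, so one approximating sequence serves all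
  -- `j`.
  obtain ⟨s, hs⟩ := (hM 0).1
  refine exists_measurable_ae_eq_comp (V := fun j ω (u : ℝ≥0) => W j u ω)
    (E := fun n p => (s n).integral (fun u => p u.toNNReal)) (fun j => (hW j).measurable_path)
    (fun j => (hW j).map_eq (hW 0))
    (fun n => (s n).measurable_integral fun u _ => measurable_pi_apply _) fun j ns hns => ?_
  obtain ⟨ms, hms, hae⟩ := (((hM j).2 s hs).comp hns.tendsto_atTop).exists_seq_tendsto_ae
  refine ⟨ms, hms, hae.mono fun ω hω => hω.congr fun i => ?_⟩
  simp only [Function.comp_apply]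
  exact (s (ns (ms i))).integral_congr fun u hu => by rw [Real.coe_toNNReal u hu.1]

/-- Linearity of the drift part of `∫_0^t k_H(t, s) / σ(s) dX_s`. -/
theorem integral_kernel_div_mul {H : ℝ} {α β σ : ℝ → ℝ} (r : ℝ)
    (hα : HasJ H (fun s => α s / σ s)) (hβ : HasJ H (fun s => β s / σ s)) {t : ℝ} (ht : 0 ≤ t) :
    ∫ s in Ioc 0 t, kernel H t s / σ s * (α s + r * β s) =
      kernelInt H (fun s => α s / σ s) t + r * kernelInt H (fun s => β s / σ s) t := by
  rcases ht.eq_or_lt with rfl | ht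
  · simp [kernelInt]
  · unfold kernelInt
    rw [← integral_const_mul, ← integral_add (hα.1 t ht) ((hβ.1 t ht).const_mul r)]
    congr 1
    ext s
    ring

/-- The estimators of the random effects are given by one measurable functional of the random
effects and the paths of the driving noises. -/
theorem exists_measurable_phiHat {Ω : Type*} [MeasurableSpace Ω] {P : Measure Ω}
    [IsProbabilityMeasure P] {H : ℝ} (hH : H ∈ Ioo (1 / 2 : ℝ) 1) {T : ℝ} (hT : 0 < T)
    {a b σ : ℝ → ℝ} {W : ℕ → ℝ → Ω → ℝ} (hW : ∀ j, IsFBM P H (W j))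
    {φ : ℕ → Ω → ℝ} {X : ℕ → ℝ → Ω → ℝ}
    (hJ₂ : HasJ H (fun s => b s / σ s))
    (hJ₁ : ∀ j, ∀ᵐ ω ∂P, HasJ H (fun s => a (X j s ω) / σ s) ∧
      ∀ S, 0 < S → IntegrableOn (fun t => J₁ H a σ (fun s => X j s ω) t ^ 2) (Ioc 0 S) (dw H))
    {Z : ℕ → ℝ → Ω → ℝ}
    (hZ : ∀ j, ∀ t ∈ Icc 0 T, IsDiffusionIntegral P H a b σ (φ j) (W j) (X j)
      (fun s => kernel H t s / σ s) t (Z j t))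
    {I : ℕ → Ω → ℝ} (hI : ∀ j, IsSemimartingaleIntegral P H (Z j) (J₂ H b σ) T (I j))
    (hA1 : ∀ S, 0 < S → IntegrableOn (fun t => J₂ H b σ t ^ 2) (Ioc 0 S) (dw H)) :
    ∃ Ψ : ℝ × (ℝ≥0 → ℝ) → ℝ, Measurable Ψ ∧ ∀ j,
      (fun ω => phiHat H a b σ T (fun t => X j t ω) (I j ω)) =ᵐ[P]
        fun ω => Ψ (φ j ω, fun u : ℝ≥0 => W j u ω) := by
  let M : ℕ → ℝ → Ω → ℝ := fun j t ω =>
    Z j t ω - ∫ s in Ioc 0 t, kernel H t s / σ s * (a (X j s ω) + φ j ω * b s)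
  have hΦ : ∀ t ∈ Icc 0 T, ∃ Φ : (ℝ≥0 → ℝ) → ℝ, Measurable Φ ∧
      ∀ j, M j t =ᵐ[P] fun ω => Φ (fun u : ℝ≥0 => W j u ω) := fun t ht =>
    exists_measurable_wienerIntegral hW fun j => (hZ j t ht).2
  choose! Φ hΦm hΦ using hΦ
  obtain ⟨s, hs⟩ := (hI 0).1
  set c := ∫ t in Ioc 0 T, J₂ H b σ t ^ 2 ∂(dw H) with hc
  have hlim₂ : Tendsto (fun n => (s n).integral (kernelInt H (fun s => b s / σ s))) atTop (𝓝 c) := by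
    have := tendsto_integral_kernelInt hH hJ₂ hT (hA1 T hT) (measurable_J _ _) (hA1 T hT) hs
    simpa only [hc, J₂, ← pow_two] using this
  obtain ⟨G, hGm, hG⟩ := exists_measurable_ae_eq_comp (P := P) (V := fun j ω (u : ℝ≥0) => W j u ω)
    (E := fun n p => (s n).integral (fun u => Φ u p))
    -- This is `∫ J₂ dM`, the noise part of `∫ J₂ dZ`: the limits of both drift contributions are
    -- subtracted.
    (L := fun j ω => I j ω -
      (∫ t in Ioc 0 T, J₁ H a σ (fun t => X j t ω) t * J₂ H b σ t ∂(dw H)) - φ j ω * c)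
    (fun j => (hW j).measurable_path) (fun j => (hW j).map_eq (hW 0))
    (fun n => (s n).measurable_integral fun u hu => hΦm u hu) (by
      intro j ns hns
      obtain ⟨ms, hms, hae⟩ := (((hI j).2 s hs).comp hns.tendsto_atTop).exists_seq_tendsto_ae
      refine ⟨ms, hms, ?_⟩
      have hM : ∀ᵐ ω ∂P, ∀ n, (s n).integral (fun u => M j u ω) =
          (s n).integral (fun u => Φ u (fun u : ℝ≥0 => W j u ω)) :=
        ae_all_iff.2 fun n => (s n).ae_integral_eq fun u hu => hΦ u hu j
      filter_upwards [hae, hM, hJ₁ j] with ω h1 h2 h3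
      have hsub : Tendsto (fun i => ns (ms i)) atTop atTop :=
        hns.tendsto_atTop.comp hms.tendsto_atTop
      have hlim₁ := (tendsto_integral_kernelInt hH h3.1 hT (h3.2 T hT) (measurable_J _ _)
        (hA1 T hT) hs).comp hsub
      refine ((h1.sub hlim₁).sub ((hlim₂.comp hsub).const_mul (φ j ω))).congr fun i => ?_
      rw [← h2]
      -- The decomposition `Z = M +` drift primitives is exact for each path at which `J₁` is well
      -- defined.
      have h4 : (s (ns (ms i))).integral (fun u => Z j u ω) = (s (ns (ms i))).integral
          (fun u => M j u ω + (kernelInt H (fun s => a (X j s ω) / σ s) u +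
            φ j ω * kernelInt H (fun s => b s / σ s) u)) := by
        refine (s _).integral_congr fun u hu => ?_
        have := integral_kernel_div_mul (φ j ω) h3.1 hJ₂ hu.1
        simp only [M, this]
        ring
      rw [StepFun.integral_add, StepFun.integral_add, StepFun.integral_const_mul] at h4
      simp only [Function.comp_apply, h4]
      ring)
  -- Leaving `c` uncancelled makes the numerators agree identically, so `c = 0` is not a separate
  -- case.
  refine ⟨fun p => (p.1 * c + G p.2) / c,
    ((measurable_fst.mul_const c).add (hGm.comp measurable_snd)).div_const c, fun j => ?_⟩
  filter_upwards [hG j] with ω hω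
  simp only [Function.comp_apply] at hω
  simp only [phiHat, ← hc, ← hω]
  ring

/-- The estimators of the random effects are independent and identically distributed. -/
theorem phiHat_iid {Ω : Type*} [MeasurableSpace Ω] {P : Measure Ω}
    [IsProbabilityMeasure P] {H : ℝ} (hH : H ∈ Ioo (1 / 2 : ℝ) 1) {T : ℝ} (hT : 0 < T)
    {a b σ : ℝ → ℝ} {W : ℕ → ℝ → Ω → ℝ} (hW : ∀ j, IsFBM P H (W j))
    (hW_indep : iIndepFun (fun j ω (t : ℝ≥0) => W j t ω) P)
    {φ : ℕ → Ω → ℝ} (hφ : ∀ j, Measurable (φ j)) (hφ_indep : iIndepFun φ P)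
    (hφ_law : ∀ j, P.map (φ j) = P.map (φ 0))
    (hφW : IndepFun (fun ω j => φ j ω) (fun ω j (t : ℝ≥0) => W j t ω) P) {X : ℕ → ℝ → Ω → ℝ}
    (hJ₂ : HasJ H (fun s => b s / σ s))
    (hJ₁ : ∀ j, ∀ᵐ ω ∂P, HasJ H (fun s => a (X j s ω) / σ s) ∧
      ∀ S, 0 < S → IntegrableOn (fun t => J₁ H a σ (fun s => X j s ω) t ^ 2) (Ioc 0 S) (dw H))
    {Z : ℕ → ℝ → Ω → ℝ}
    (hZ : ∀ j, ∀ t ∈ Icc 0 T, IsDiffusionIntegral P H a b σ (φ j) (W j) (X j)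
      (fun s => kernel H t s / σ s) t (Z j t))
    {I : ℕ → Ω → ℝ} (hI : ∀ j, IsSemimartingaleIntegral P H (Z j) (J₂ H b σ) T (I j))
    (hA1 : ∀ S, 0 < S → IntegrableOn (fun t => J₂ H b σ t ^ 2) (Ioc 0 S) (dw H))
    {Y : ℕ → Ω → ℝ} (hY : ∀ j ω, Y j ω = phiHat H a b σ T (fun t => X j t ω) (I j ω)) :
    iIndepFun Y P ∧ ∀ j, IdentDistrib (Y j) (Y 0) P P := by
  obtain ⟨Ψ, hΨ, hΨY⟩ := exists_measurable_phiHat hH hT hW hJ₂ hJ₁ hZ hI hA1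
  have hYΨ : ∀ j, Y j =ᵐ[P] fun ω => Ψ (φ j ω, fun u : ℝ≥0 => W j u ω) := fun j =>
    (funext (hY j) : Y j = _) ▸ hΨY j
  have hWm : ∀ j, Measurable (fun ω (t : ℝ≥0) => W j t ω) := fun j => (hW j).measurable_path
  refine ⟨?_, fun j => ?_⟩
  · exact ((iIndepFun_prodMk_of_indepFun hφ hWm hφ_indep hW_indep hφW).comp (fun _ => Ψ)
      fun _ => hΨ).congr fun j => (hYΨ j).symm
  · have hlaw : ∀ j, P.map (fun ω => (φ j ω, fun u : ℝ≥0 => W j u ω)) =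
        (P.map (φ j)).prod (P.map (fun ω (u : ℝ≥0) => W j u ω)) := fun j =>
      (indepFun_iff_map_prod_eq_prod_map_map (hφ j).aemeasurable (hWm j).aemeasurable).1
        (hφW.comp (measurable_pi_apply j) (measurable_pi_apply j))
    have hid : IdentDistrib (fun ω => (φ j ω, fun u : ℝ≥0 => W j u ω))
        (fun ω => (φ 0 ω, fun u : ℝ≥0 => W 0 u ω)) P P :=
      ⟨((hφ j).prodMk (hWm j)).aemeasurable, ((hφ 0).prodMk (hWm 0)).aemeasurable, by
        rw [hlaw j, hlaw 0, hφ_law j, (hW j).map_eq (hW 0)]⟩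
    have h := hid.comp hΨ
    have hmeas : ∀ j, AEMeasurable (Y j) P := fun j =>
      (hΨ.comp ((hφ j).prodMk (hWm j))).aemeasurable.congr (hYΨ j).symm
    refine ⟨hmeas j, hmeas 0, ?_⟩
    rw [Measure.map_congr (hYΨ j), Measure.map_congr (hYΨ 0)]
    exact h.map_eq

/-! ### Collision probability of two binomial variables -/

theorem integral_cos_sub_natCast_mul (k l : ℕ) :
    ∫ θ in (-Real.pi)..Real.pi, Real.cos (((k : ℝ) - l) * θ) = if k = l then 2 * Real.pi else 0 := by
  split_ifs with h
  · subst h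
    simp
    ring
  · have hne : ((k : ℝ) - l) ≠ 0 := sub_ne_zero.2 (by exact_mod_cast h)
    have hsin : Real.sin (((k : ℝ) - l) * Real.pi) = 0 := by
      have := Real.sin_int_mul_pi ((k : ℤ) - l)
      push_cast at this
      exact this
    rw [intervalIntegral.integral_comp_mul_left (fun y => Real.cos y) hne, integral_cos,
      mul_neg, Real.sin_neg, hsin]
    simp

/-- Parseval's identity for a real trigonometric polynomial with nonnegative frequencies. -/
theorem integral_sq_add_sq_trigSum (N : ℕ) (p : ℕ → ℝ) :
    ∫ θ in (-Real.pi)..Real.pi, ((∑ k ∈ Finset.range N, p k * Real.cos (k * θ)) ^ 2 +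
      (∑ k ∈ Finset.range N, p k * Real.sin (k * θ)) ^ 2) =
      2 * Real.pi * ∑ k ∈ Finset.range N, p k ^ 2 := by
  have h1 : ∀ θ : ℝ, (∑ k ∈ Finset.range N, p k * Real.cos (k * θ)) ^ 2 +
      (∑ k ∈ Finset.range N, p k * Real.sin (k * θ)) ^ 2 =
      ∑ k ∈ Finset.range N, ∑ l ∈ Finset.range N, p k * p l * Real.cos (((k : ℝ) - l) * θ) := by
    intro θ
    rw [pow_two, pow_two, Finset.sum_mul_sum, Finset.sum_mul_sum, ← Finset.sum_add_distrib]
    refine Finset.sum_congr rfl fun k _ => ?_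
    rw [← Finset.sum_add_distrib]
    refine Finset.sum_congr rfl fun l _ => ?_
    rw [sub_mul, Real.cos_sub]
    ring
  simp_rw [h1]
  rw [intervalIntegral.integral_finsetSum fun k _ => (by fun_prop : Continuous _).intervalIntegrable
    _ _, Finset.mul_sum]
  refine Finset.sum_congr rfl fun k hk => ?_
  rw [intervalIntegral.integral_finsetSum fun k _ => (by fun_prop : Continuous _).intervalIntegrable
    _ _]
  simp_rw [intervalIntegral.integral_const_mul, integral_cos_sub_natCast_mul]
  simp only [mul_ite, mul_zero, Finset.sum_ite_eq, hk, if_true]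
  ring

/-- The characteristic function of the binomial law, from the binomial theorem. -/
theorem sum_bernstein_mul_exp (N : ℕ) (x θ : ℝ) :
    ∑ k ∈ Finset.range (N + 1), (((bernsteinPolynomial ℝ N k).eval x : ℝ) : ℂ) *
      Complex.exp ((k * θ : ℝ) * Complex.I) =
      ((x : ℂ) * Complex.exp (θ * Complex.I) + (1 - x)) ^ N := by
  rw [add_pow]
  refine Finset.sum_congr rfl fun k _ => ?_
  have : Complex.exp ((k * θ : ℝ) * Complex.I) = Complex.exp (θ * Complex.I) ^ k := by
    rw [← Complex.exp_nat_mul]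
    congr 1
    push_cast
    ring
  rw [this]
  simp [bernsteinPolynomial]
  ring

/-- Parseval applied to the binomial characteristic function, with `|x e^{iθ} + 1 - x|² = 1 -
2x(1-x)(1 - cos θ)`. -/
theorem sum_sq_bernstein_eq_integral (N : ℕ) (x : ℝ) :
    2 * Real.pi * ∑ k ∈ Finset.range (N + 1), (bernsteinPolynomial ℝ N k).eval x ^ 2 =
      ∫ θ in (-Real.pi)..Real.pi, (1 - 2 * (x * (1 - x)) * (1 - Real.cos θ)) ^ N := by
  rw [← integral_sq_add_sq_trigSum]
  congr 1
  ext θ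
  have h := congrArg Complex.normSq (sum_bernstein_mul_exp N x θ)
  rw [map_pow, Complex.normSq_apply, Complex.normSq_apply, Complex.re_sum, Complex.im_sum] at h
  simp only [Complex.re_ofReal_mul, Complex.im_ofReal_mul, Complex.exp_ofReal_mul_I_re,
    Complex.exp_ofReal_mul_I_im, Complex.add_re, Complex.add_im, Complex.sub_re, Complex.sub_im,
    Complex.one_re, Complex.one_im, Complex.ofReal_re, Complex.ofReal_im] at h
  rw [pow_two, pow_two, h]
  congr 1
  linear_combination x ^ 2 * Real.sin_sq_add_cos_sq θ

theorem tendsto_natCast_mul_one_sub_cos_div_sqrt (u : ℝ) :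
    Tendsto (fun N : ℕ => (N : ℝ) * (1 - Real.cos (u / √N))) atTop (𝓝 (u ^ 2 / 2)) := by
  have hN : Tendsto (fun N : ℕ => (N : ℝ)) atTop atTop := tendsto_natCast_atTop_atTop
  have hdiv : Tendsto (fun N : ℕ => u / √(N : ℝ)) atTop (𝓝 0) :=
    tendsto_const_nhds.div_atTop (Real.tendsto_sqrt_atTop.comp hN)
  have hbound : Tendsto (fun N : ℕ => u ^ 4 * (5 / 96) / (N : ℝ)) atTop (𝓝 0) :=
    tendsto_const_nhds.div_atTop hN
  rw [tendsto_iff_dist_tendsto_zero]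
  refine squeeze_zero' (Eventually.of_forall fun _ => dist_nonneg) ?_ hbound
  have h1 : ∀ᶠ N : ℕ in atTop, |u / √(N : ℝ)| ≤ 1 := by
    have := hdiv.abs
    rw [abs_zero] at this
    exact this.eventually_le_const (by norm_num)
  filter_upwards [h1, eventually_gt_atTop 0] with N h hpos
  have hNpos : (0 : ℝ) < N := by exact_mod_cast hpos
  have hb := Real.cos_bound h
  have hsq : (u / √(N : ℝ)) ^ 2 = u ^ 2 / N := by rw [div_pow, Real.sq_sqrt hNpos.le]
  have h4 : |u / √(N : ℝ)| ^ 4 = u ^ 4 / N ^ 2 := by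
    rw [show |u / √(N : ℝ)| ^ 4 = ((u / √(N : ℝ)) ^ 2) ^ 2 by
      rw [Even.pow_abs (by decide)]; ring, hsq]
    ring
  rw [hsq, h4] at hb
  rw [Real.dist_eq]
  have e1 : (N : ℝ) * (1 - Real.cos (u / √N)) - u ^ 2 / 2 =
      -((N : ℝ) * (Real.cos (u / √N) - (1 - u ^ 2 / N / 2))) := by
    field_simp
    ring
  rw [e1, abs_neg, abs_mul, abs_of_pos hNpos]
  calc (N : ℝ) * |Real.cos (u / √N) - (1 - u ^ 2 / N / 2)| ≤ N * (u ^ 4 / N ^ 2 * (5 / 96)) := by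
        gcongr
    _ = _ := by field_simp

/-- Local central limit theorem for the collision probability of two independent binomial
variables. -/
theorem tendsto_sqrt_mul_sum_sq_bernstein {x : ℝ} (hx : x ∈ Ioo (0 : ℝ) 1) :
    Tendsto (fun N : ℕ => √(N : ℝ) *
      ∑ k ∈ Finset.range (N + 1), (bernsteinPolynomial ℝ N k).eval x ^ 2) atTop (𝓝 (psi x)) := by
  set q := x * (1 - x) with hq
  have hq0 : 0 < q := mul_pos hx.1 (by linarith [hx.2])
  -- This keeps the base `1 - 2q(1 - cos θ)`, which is at least `1 - 4q`, nonnegative.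
  have hq1 : 4 * q ≤ 1 := by nlinarith [sq_nonneg (1 - 2 * x)]
  -- The integrand after the substitution `θ = u/√N`, extended by zero to the whole line for
  -- dominated convergence.
  let F : ℕ → ℝ → ℝ := fun N => (Ioc (-(Real.pi * √N)) (Real.pi * √N)).indicator
    fun u => (1 - 2 * q * (1 - Real.cos (u / √N))) ^ N
  have hF : ∀ᶠ N : ℕ in atTop, ∫ u, F N u = 2 * Real.pi * (√(N : ℝ) *
      ∑ k ∈ Finset.range (N + 1), (bernsteinPolynomial ℝ N k).eval x ^ 2) := by
    filter_upwards [eventually_gt_atTop 0] with N hN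
    have hs : (0 : ℝ) < √N := Real.sqrt_pos.2 (by exact_mod_cast hN)
    have hle : -(Real.pi * √(N : ℝ)) ≤ Real.pi * √(N : ℝ) := by
      have := mul_pos Real.pi_pos hs
      linarith
    rw [integral_indicator measurableSet_Ioc, ← intervalIntegral.integral_of_le hle,
      intervalIntegral.integral_comp_div (fun θ => (1 - 2 * q * (1 - Real.cos θ)) ^ N) hs.ne',
      neg_div, mul_div_cancel_right₀ _ hs.ne', ← sum_sq_bernstein_eq_integral, smul_eq_mul]
    ring
  have hlim : Tendsto (fun N => ∫ u, F N u) atTop (𝓝 (∫ u : ℝ, Real.exp (-q * u ^ 2))) := by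
    refine tendsto_integral_of_dominated_convergence
      (fun u => Real.exp (-(4 * q / Real.pi ^ 2) * u ^ 2)) (fun N => ?_) ?_ (fun N => ?_) ?_
    · exact ((by fun_prop : Measurable _).indicator measurableSet_Ioc).aestronglyMeasurable
    · exact integrable_exp_neg_mul_sq (by positivity)
    · refine Eventually.of_forall fun u => ?_
      by_cases hu : u ∈ Ioc (-(Real.pi * √(N : ℝ))) (Real.pi * √(N : ℝ))
      · simp only [F, indicator_of_mem hu]
        have hs : (0 : ℝ) < √N := by
          by_contra h
          have : √(N : ℝ) = 0 := le_antisymm (not_lt.1 h) (Real.sqrt_nonneg _)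
          simp [this] at hu
        have hN : (0 : ℝ) < N := Real.sqrt_pos.1 hs
        -- This quadratic bound holds on all of `[-π, π]` and yields the Gaussian envelope `exp(-4q
        -- u²/π²)`, uniform in `N`.
        have h1 : Real.cos (u / √N) ≤ 1 - 2 / Real.pi ^ 2 * (u / √N) ^ 2 := by
          refine Real.cos_le_one_sub_mul_cos_sq ?_
          rw [abs_div, abs_of_pos hs, div_le_iff₀ hs]
          exact abs_le.2 ⟨hu.1.le, hu.2⟩
        rw [div_pow, Real.sq_sqrt hN.le] at h1
        have h2 := Real.neg_one_le_cos (u / √N)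
        have h3 : 0 ≤ 1 - 2 * q * (1 - Real.cos (u / √N)) := by nlinarith
        rw [Real.norm_of_nonneg (pow_nonneg h3 _)]
        calc (1 - 2 * q * (1 - Real.cos (u / √N))) ^ N
            ≤ Real.exp (-(2 * q * (1 - Real.cos (u / √N)))) ^ N :=
              pow_le_pow_left₀ h3 (by
                have := Real.add_one_le_exp (-(2 * q * (1 - Real.cos (u / √N))))
                linarith) _
          _ = Real.exp (-(N * (2 * q * (1 - Real.cos (u / √N))))) := by
              rw [← Real.exp_nat_mul]; congr 1; ring
          _ ≤ _ := by
              refine Real.exp_le_exp.2 ?_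
              have h4 : 2 / Real.pi ^ 2 * (u ^ 2 / N) ≤ 1 - Real.cos (u / √N) := by linarith
              have h5 : (N : ℝ) * (2 * q * (2 / Real.pi ^ 2 * (u ^ 2 / N))) ≤
                  N * (2 * q * (1 - Real.cos (u / √N))) := by gcongr
              have h6 : (N : ℝ) * (2 * q * (2 / Real.pi ^ 2 * (u ^ 2 / N))) =
                  4 * q / Real.pi ^ 2 * u ^ 2 := by
                field_simp
                ring
              linarith
      · simp only [F, indicator_of_notMem hu, norm_zero]
        positivity
    · refine Eventually.of_forall fun u => ?_
      have hev : ∀ᶠ N : ℕ in atTop, u ∈ Ioc (-(Real.pi * √(N : ℝ))) (Real.pi * √(N : ℝ)) := by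
        have : Tendsto (fun N : ℕ => Real.pi * √(N : ℝ)) atTop atTop :=
          (Real.tendsto_sqrt_atTop.comp tendsto_natCast_atTop_atTop).const_mul_atTop Real.pi_pos
        filter_upwards [this.eventually_gt_atTop |u|] with N hN
        exact ⟨(abs_lt.1 hN).1, (abs_lt.1 hN).2.le⟩
      have h1 : Tendsto (fun N : ℕ => (1 + -(2 * q * (1 - Real.cos (u / √N)))) ^ N) atTop
          (𝓝 (Real.exp (-q * u ^ 2))) := by
        refine Real.tendsto_one_add_pow_exp_of_tendsto ?_
        have h2 := (tendsto_natCast_mul_one_sub_cos_div_sqrt u).const_mul (-(2 * q))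
        rw [show -(2 * q) * (u ^ 2 / 2) = -q * u ^ 2 by ring] at h2
        exact h2.congr fun N => by ring
      refine h1.congr' ?_
      filter_upwards [hev] with N hN
      simp only [F, indicator_of_mem hN]
      ring
  rw [integral_gaussian] at hlim
  have hpsi : psi x = (2 * Real.pi)⁻¹ * √(Real.pi / q) := by
    have h1 : 4 * Real.pi * x * (1 - x) = 4 * Real.pi * q := by rw [hq]; ring
    have hπ := Real.pi_pos
    rw [psi, h1, Real.rpow_neg (by positivity), ← Real.sqrt_eq_rpow,
      inv_eq_iff_eq_inv, mul_inv, inv_inv, ← Real.sqrt_inv, inv_div]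
    rw [show 4 * Real.pi * q = (2 * Real.pi) ^ 2 * (q / Real.pi) by field_simp; ring,
      Real.sqrt_mul (by positivity), Real.sqrt_sq (by positivity)]
  rw [hpsi]
  refine ((hlim.congr' hF).const_mul (2 * Real.pi)⁻¹).congr fun N => ?_
  rw [inv_mul_cancel_left₀ (by positivity)]

/-! ### Central limit theorem for triangular arrays -/

theorem norm_exp_mul_I_sub_taylor_le {y : ℝ} (hy : |y| ≤ 1) :
    ‖Complex.exp (y * Complex.I) - (1 + y * Complex.I - y ^ 2 / 2)‖ ≤ |y| ^ 3 := by
  have hn : ‖(y : ℂ) * Complex.I‖ = |y| := by simp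
  have h := Complex.exp_bound (x := y * Complex.I) (by rw [hn]; exact hy) (n := 3) (by norm_num)
  rw [hn] at h
  simp only [Finset.sum_range_succ, Finset.sum_range_zero] at h
  have e : (0 : ℂ) + ((y : ℂ) * Complex.I) ^ 0 / (Nat.factorial 0 : ℂ) +
      ((y : ℂ) * Complex.I) ^ 1 / (Nat.factorial 1 : ℂ) +
      ((y : ℂ) * Complex.I) ^ 2 / (Nat.factorial 2 : ℂ) = 1 + y * Complex.I - y ^ 2 / 2 := by
    simp [Nat.factorial, mul_pow]
    ring
  rw [e] at h
  refine h.trans (mul_le_of_le_one_right (by positivity) ?_)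
  -- The constant in the exponential remainder bound is `4/(3! · 3) = 2/9`.
  norm_num [Nat.factorial]

/-- Second order expansion of the characteristic function of a bounded centered variable. -/
theorem norm_charFun_sub_le {μ : Measure ℝ} [IsProbabilityMeasure μ] {ζ : ℝ → ℝ}
    (hζ : Measurable ζ) {B : ℝ} (hB : ∀ y, |ζ y| ≤ B) (h0 : ∫ y, ζ y ∂μ = 0) {t : ℝ}
    (ht : |t| * B ≤ 1) :
    ‖charFun (μ.map ζ) t - 1 - ((-(t ^ 2 / 2) * ∫ y, ζ y ^ 2 ∂μ : ℝ) : ℂ)‖ ≤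
      |t| ^ 3 * B * ∫ y, ζ y ^ 2 ∂μ := by
  have hB0 : 0 ≤ B := (abs_nonneg _).trans (hB 0)
  have hint : Integrable ζ μ := Integrable.of_bound hζ.aestronglyMeasurable B
    (Eventually.of_forall hB)
  have hint2 : Integrable (fun y => ζ y ^ 2) μ :=
    Integrable.of_bound (hζ.pow_const 2).aestronglyMeasurable (B ^ 2)
      (Eventually.of_forall fun y => by
        rw [Real.norm_eq_abs, abs_pow]
        exact pow_le_pow_left₀ (abs_nonneg _) (hB y) 2)
  have hexp : Integrable (fun y => Complex.exp ((t * ζ y : ℝ) * Complex.I)) μ :=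
    Integrable.of_bound (by fun_prop) 1 (Eventually.of_forall fun y => by
      rw [Complex.norm_exp_ofReal_mul_I])
  have hpoly : Integrable (fun y => (1 + (t * ζ y : ℝ) * Complex.I -
      ((t * ζ y : ℝ) : ℂ) ^ 2 / 2)) μ := by
    have h1 : Integrable (fun y => ((t * ζ y : ℝ) : ℂ)) μ := (hint.const_mul t).ofReal
    have h2 : Integrable (fun y => (((t ^ 2 / 2) * ζ y ^ 2 : ℝ) : ℂ)) μ :=
      (hint2.const_mul _).ofReal
    refine (((integrable_const 1).add (h1.mul_const Complex.I)).sub h2).congr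
      (Eventually.of_forall fun y => ?_)
    simp only [Pi.sub_apply, Pi.add_apply]
    push_cast
    ring
  have hpint : ∫ y, (1 + (t * ζ y : ℝ) * Complex.I - ((t * ζ y : ℝ) : ℂ) ^ 2 / 2) ∂μ =
      1 + ((-(t ^ 2 / 2) * ∫ y, ζ y ^ 2 ∂μ : ℝ) : ℂ) := by
    have h1 : Integrable (fun y => ((ζ y : ℝ) : ℂ)) μ := hint.ofReal
    have h2 : Integrable (fun y => ((ζ y ^ 2 : ℝ) : ℂ)) μ := hint2.ofReal
    have e : ∀ y, (1 + (t * ζ y : ℝ) * Complex.I - ((t * ζ y : ℝ) : ℂ) ^ 2 / 2) =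
        (1 + (t * Complex.I) * (ζ y : ℂ)) + (-(t ^ 2 / 2 : ℂ)) * ((ζ y ^ 2 : ℝ) : ℂ) := fun y => by
      push_cast
      ring
    simp_rw [e]
    have h3 : Integrable (fun y => 1 + (t * Complex.I) * (ζ y : ℂ)) μ :=
      (integrable_const _).add (h1.const_mul _)
    rw [integral_add h3 (h2.const_mul _),
      integral_add (integrable_const _) (h1.const_mul _), integral_const_mul, integral_const_mul,
      integral_complex_ofReal, integral_complex_ofReal, h0]
    simp
  have hchar : charFun (μ.map ζ) t = ∫ y, Complex.exp ((t * ζ y : ℝ) * Complex.I) ∂μ := by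
    rw [charFun_apply_real, integral_map hζ.aemeasurable (by fun_prop)]
    simp
  rw [hchar, sub_sub, ← hpint, ← integral_sub hexp hpoly, ← integral_const_mul]
  refine norm_integral_le_of_norm_le (hint2.const_mul _) (Eventually.of_forall fun y => ?_)
  have hy : |t * ζ y| ≤ |t| * B := by
    rw [abs_mul]
    exact mul_le_mul_of_nonneg_left (hB y) (abs_nonneg _)
  refine (norm_exp_mul_I_sub_taylor_le (hy.trans ht)).trans ?_
  rw [abs_mul, mul_pow]
  -- One factor `|ζ|` is bounded by `B`, so the remainder is `B` times the variance and vanishes in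
  -- the limit after summation over a row.
  calc |t| ^ 3 * |ζ y| ^ 3 = |t| ^ 3 * |ζ y| * |ζ y| ^ 2 := by ring
    _ ≤ |t| ^ 3 * B * |ζ y| ^ 2 := by gcongr; exact hB y
    _ = _ := by rw [sq_abs]

/-- Central limit theorem for triangular arrays whose rows are uniformly small centered functions of
independent identically distributed variables. -/
theorem tendstoInDistribution_triangular {Ω : Type*} [MeasurableSpace Ω] {P : Measure Ω}
    [IsProbabilityMeasure P] {Y : ℕ → Ω → ℝ} (hindep : iIndepFun Y P)
    (hident : ∀ j, IdentDistrib (Y j) (Y 0) P P) {ζ : ℕ → ℝ → ℝ} (hζ : ∀ n, Measurable (ζ n))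
    {B : ℕ → ℝ} (hB : ∀ n y, |ζ n y| ≤ B n) (hB0 : Tendsto B atTop (𝓝 0))
    (h0 : ∀ n, ∫ y, ζ n y ∂(P.map (Y 0)) = 0) {v : ℝ} (hv : 0 ≤ v)
    (hvar : Tendsto (fun n : ℕ => (n : ℝ) * ∫ y, ζ n y ^ 2 ∂(P.map (Y 0))) atTop (𝓝 v)) :
    TendstoInDistribution (fun (n : ℕ) ω => ∑ j ∈ Finset.range n, ζ n (Y j ω)) atTop
      (id : ℝ → ℝ) (fun _ => P) (gaussianReal 0 v.toNNReal) := by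
  have hYm : ∀ j, AEMeasurable (Y j) P := fun j => (hident j).aemeasurable_fst
  have hμ : IsProbabilityMeasure (P.map (Y 0)) := Measure.isProbabilityMeasure_map (hYm 0)
  have hζY : ∀ n j, AEMeasurable (fun ω => ζ n (Y j ω)) P := fun n j =>
    (hζ n).comp_aemeasurable (hYm j)
  refine ⟨fun n => Finset.aemeasurable_fun_sum _ fun j _ => hζY n j, by fun_prop, ?_⟩
  refine ProbabilityMeasure.tendsto_iff_tendsto_charFun.2 fun t => ?_
  have hchar : ∀ n : ℕ, charFun (P.map (fun ω => ∑ j ∈ Finset.range n, ζ n (Y j ω))) t =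
      (1 + (charFun ((P.map (Y 0)).map (ζ n)) t - 1)) ^ n := fun n => by
    have hi : iIndepFun (fun j ω => ζ n (Y j ω)) P := hindep.comp (fun _ => ζ n) fun _ => hζ n
    rw [(hi.restrict _).charFun_map_fun_finsetSum_eq_prod (fun _ _ => hζY n _)]
    have hj : ∀ j, P.map (fun ω => ζ n (Y j ω)) = (P.map (Y 0)).map (ζ n) := fun j => by
      rw [← (hident j).map_eq, AEMeasurable.map_map_of_aemeasurable (hζ n).aemeasurable (hYm j)]
      rfl
    simp [hj]
  have hlim : Tendsto (fun n : ℕ => (n : ℂ) * (charFun ((P.map (Y 0)).map (ζ n)) t - 1)) atTop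
      (𝓝 ((-(t ^ 2 / 2) * v : ℝ) : ℂ)) := by
    have h1 : Tendsto (fun n : ℕ =>
        ((-(t ^ 2 / 2) * ((n : ℝ) * ∫ y, ζ n y ^ 2 ∂(P.map (Y 0))) : ℝ) : ℂ)) atTop
        (𝓝 ((-(t ^ 2 / 2) * v : ℝ) : ℂ)) :=
      (Complex.continuous_ofReal.tendsto _).comp (hvar.const_mul _)
    have h2 : Tendsto (fun n : ℕ => |t| ^ 3 * B n * ((n : ℝ) * ∫ y, ζ n y ^ 2 ∂(P.map (Y 0))))
        atTop (𝓝 0) := by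
      simpa using (hB0.const_mul (|t| ^ 3)).mul hvar
    have h3 : ∀ᶠ n in atTop, |t| * B n ≤ 1 := by
      have : Tendsto (fun n => |t| * B n) atTop (𝓝 0) := by simpa using hB0.const_mul |t|
      exact this.eventually_le_const (by norm_num)
    have h4 : Tendsto (fun n : ℕ => (n : ℂ) * (charFun ((P.map (Y 0)).map (ζ n)) t - 1) -
        ((-(t ^ 2 / 2) * ((n : ℝ) * ∫ y, ζ n y ^ 2 ∂(P.map (Y 0))) : ℝ) : ℂ)) atTop (𝓝 0) := by
      refine squeeze_zero_norm' ?_ h2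
      filter_upwards [h3] with n hn
      have h5 := norm_charFun_sub_le (hζ n) (hB n) (h0 n) hn
      have e : (n : ℂ) * (charFun ((P.map (Y 0)).map (ζ n)) t - 1) -
          ((-(t ^ 2 / 2) * ((n : ℝ) * ∫ y, ζ n y ^ 2 ∂(P.map (Y 0))) : ℝ) : ℂ) =
          (n : ℂ) * (charFun ((P.map (Y 0)).map (ζ n)) t - 1 -
            ((-(t ^ 2 / 2) * ∫ y, ζ n y ^ 2 ∂(P.map (Y 0)) : ℝ) : ℂ)) := by
        push_cast
        ring
      rw [e, norm_mul, Complex.norm_natCast]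
      calc (n : ℝ) * _ ≤ n * (|t| ^ 3 * B n * ∫ y, ζ n y ^ 2 ∂(P.map (Y 0))) :=
            mul_le_mul_of_nonneg_left h5 (Nat.cast_nonneg n)
        _ = _ := by ring
    simpa using h4.add h1
  have hg : charFun ((gaussianReal 0 v.toNNReal).map id) t =
      Complex.exp ((-(t ^ 2 / 2) * v : ℝ) : ℂ) := by
    rw [Measure.map_id, charFun_gaussianReal, Real.coe_toNNReal v hv]
    congr 1
    push_cast
    ring
  simp only [ProbabilityMeasure.coe_mk, hg]
  exact (Complex.tendsto_one_add_pow_exp_of_tendsto hlim).congr fun n => (hchar n).symm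

/-! ### Binomial weights and cell probabilities -/

theorem bernstein_eval_nonneg {x : ℝ} (hx : x ∈ Icc (0 : ℝ) 1) (N k : ℕ) :
    0 ≤ (bernsteinPolynomial ℝ N k).eval x := by
  have h0 := hx.1
  have h1 : 0 ≤ 1 - x := by linarith [hx.2]
  simp only [bernsteinPolynomial, Polynomial.eval_mul, Polynomial.eval_natCast,
    Polynomial.eval_pow, Polynomial.eval_X, Polynomial.eval_sub, Polynomial.eval_one]
  positivity

theorem sum_bernstein_eval {m : ℕ} (hm : 0 < m) (x : ℝ) :
    ∑ k ∈ Finset.range m, (bernsteinPolynomial ℝ (m - 1) k).eval x = 1 := by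
  have h := congrArg (Polynomial.eval x) (bernsteinPolynomial.sum ℝ (m - 1))
  rw [Nat.sub_add_cancel hm, Polynomial.eval_finsetSum, Polynomial.eval_one] at h
  exact h

/-- The indices of the cells away from `x`. -/
noncomputable def farCells (x δ : ℝ) (m : ℕ) : Finset ℕ :=
  (Finset.range m).filter fun k : ℕ => δ / 2 ≤ |(k : ℝ) / m - x|

/-- Chebyshev's inequality for the binomial weights. -/
theorem sum_bernstein_far_le {x : ℝ} (hx : x ∈ Icc (0 : ℝ) 1) {δ : ℝ} (hδ : 0 < δ) {m : ℕ}
    (hm : 4 / δ ≤ m) :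
    ∑ k ∈ farCells x δ m, (bernsteinPolynomial ℝ (m - 1) k).eval x ≤
      16 / δ ^ 2 / m := by
  have hm0 : (0 : ℝ) < m := lt_of_lt_of_le (by positivity) hm
  have hmpos : 0 < m := by exact_mod_cast hm0
  obtain ⟨N, rfl⟩ : ∃ N, m = N + 1 := ⟨m - 1, by omega⟩
  simp only [Nat.add_sub_cancel]
  push_cast at hm hm0 ⊢
  have hvar := congrArg (Polynomial.eval x) (bernsteinPolynomial.variance ℝ N)
  rw [Polynomial.eval_finsetSum] at hvar
  simp only [Polynomial.eval_mul, Polynomial.eval_pow, Polynomial.eval_sub, Polynomial.eval_natCast,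
    Polynomial.eval_X, Polynomial.eval_one, nsmul_eq_mul] at hvar
  have hδm : 4 ≤ δ * (N + 1) := by rwa [div_le_iff₀ hδ, mul_comm] at hm
  have h1 : (δ * (N + 1) / 4) ^ 2 * ∑ k ∈ farCells x δ (N + 1), (bernsteinPolynomial ℝ N k).eval x ≤ N * x * (1 - x) := by
    rw [← hvar, Finset.mul_sum]
    refine (Finset.sum_le_sum fun k hk => ?_).trans (Finset.sum_le_sum_of_subset_of_nonneg
      (Finset.filter_subset _ _) fun k _ _ =>
        mul_nonneg (sq_nonneg _) (bernstein_eval_nonneg hx N k))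
    refine mul_le_mul_of_nonneg_right ?_ (bernstein_eval_nonneg hx N k)
    have hk2 := (Finset.mem_filter.1 hk).2
    push_cast at hk2
    have e : (k : ℝ) / (N + 1) - x = (k - (N + 1) * x) / (N + 1) := by field_simp
    rw [e, abs_div, abs_of_pos hm0, le_div_iff₀ hm0] at hk2
    -- The grid has mesh `1/(N+1)` but the weights have mean `N x`. The shift `|x| ≤ 1` costs at
    -- most `δ(N+1)/4` of the distance `δ(N+1)/2`.
    have h3 : δ * (N + 1) / 4 ≤ |N * x - k| := by
      have : |(k : ℝ) - (N + 1) * x| ≤ |N * x - k| + |x| := by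
        rw [show (k : ℝ) - (N + 1) * x = -(N * x - k) - x by ring]
        exact (abs_sub _ _).trans (by rw [abs_neg])
      have hx1 : |x| ≤ 1 := abs_le.2 ⟨by linarith [hx.1], hx.2⟩
      linarith
    calc (δ * (N + 1) / 4) ^ 2 ≤ |N * x - k| ^ 2 := pow_le_pow_left₀ (by positivity) h3 2
      _ = _ := sq_abs _
  have h2 : N * x * (1 - x) ≤ (N : ℝ) + 1 := by
    have hN : (0 : ℝ) ≤ N := Nat.cast_nonneg N
    have : x * (1 - x) ≤ 1 := by nlinarith [hx.1, hx.2]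
    nlinarith
  rw [div_div, le_div_iff₀ (by positivity)]
  have h3 := h1.trans h2
  set S := ∑ k ∈ farCells x δ (N + 1), (bernsteinPolynomial ℝ N k).eval x
  have h4 : (δ * ((N : ℝ) + 1) / 4) ^ 2 * S = (N + 1) * (S * (δ ^ 2 * (N + 1)) / 16) := by ring
  rw [h4] at h3
  have h5 : S * (δ ^ 2 * ((N : ℝ) + 1)) / 16 ≤ 1 := by
    by_contra h
    nlinarith
  linarith

/-- A measure with a density continuous at `x` is close to a multiple of Lebesgue measure on small
intervals near `x`. -/
theorem exists_abs_measureReal_Ioc_sub_le {g : ℝ → ℝ} (hg : Measurable g) (hg0 : ∀ y, 0 ≤ g y)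
    {x : ℝ} (hx : ContinuousAt g x) {ε : ℝ} (hε : 0 < ε) :
    ∃ δ > 0, ∀ l r, |l - x| < δ → |r - x| < δ → l ≤ r →
      |(volume.withDensity fun y => ENNReal.ofReal (g y)).real (Ioc l r) - g x * (r - l)| ≤
        ε * (r - l) := by
  obtain ⟨δ, hδ, h⟩ := Metric.continuousAt_iff.1 hx ε hε
  refine ⟨δ, hδ, fun l r hl hr hlr => ?_⟩
  have hnear : ∀ y ∈ Ioc l r, |g y - g x| < ε := fun y hy => by
    refine h ?_
    rw [Real.dist_eq, abs_lt]
    exact ⟨by linarith [(abs_lt.1 hl).1, hy.1], by linarith [(abs_lt.1 hr).2, hy.2]⟩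
  have hint : IntegrableOn g (Ioc l r) := by
    refine Measure.integrableOn_of_bounded (M := |g x| + ε) (by simp) hg.aestronglyMeasurable ?_
    filter_upwards [ae_restrict_mem measurableSet_Ioc] with y hy
    have := hnear y hy
    rw [Real.norm_eq_abs]
    have h2 := abs_sub_abs_le_abs_sub (g y) (g x)
    linarith
  have hval : (volume.withDensity fun y => ENNReal.ofReal (g y)).real (Ioc l r) =
      ∫ y in Ioc l r, g y := by
    rw [Measure.real, withDensity_apply _ measurableSet_Ioc,
      integral_eq_lintegral_of_nonneg_ae (Eventually.of_forall hg0) hg.aestronglyMeasurable]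
  have hconst : g x * (r - l) = ∫ _ in Ioc l r, g x := by
    simp [hlr, mul_comm]
  rw [hval, hconst, ← integral_sub hint (by simp), ← Real.norm_eq_abs]
  have := norm_setIntegral_le_of_norm_le_const (μ := volume) (s := Ioc l r)
    (f := fun y => g y - g x) (C := ε) (by simp) fun y hy => (hnear y hy).le
  simpa [hlr] using this

/-- The cells `(k/m, (k+1)/m]` of the Bernstein estimator. -/
def cell (m k : ℕ) : Set ℝ := Ioc ((k : ℝ) / m) (((k : ℝ) + 1) / m)

theorem measurableSet_cell (m k : ℕ) : MeasurableSet (cell m k) := measurableSet_Ioc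

theorem cell_disjoint {m k l : ℕ} (h : k ≠ l) : Disjoint (cell m k) (cell m l) := by
  wlog hkl : k < l generalizing k l
  · exact (this h.symm (by omega)).symm
  refine Set.disjoint_left.2 fun y hk hl => ?_
  have h1 : ((k : ℝ) + 1) / m ≤ (l : ℝ) / m := by
    gcongr
    exact_mod_cast hkl
  linarith [hk.2, hl.1]

theorem sum_measureReal_cell_le (μ : Measure ℝ) [IsProbabilityMeasure μ] (m : ℕ) (s : Finset ℕ) :
    ∑ k ∈ s, μ.real (cell m k) ≤ 1 := by
  rw [← measureReal_biUnion_finset (fun k _ l _ h => cell_disjoint h)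
    fun k _ => measurableSet_cell m k]
  exact measureReal_le_one

/-- Comparison of weighted cell probabilities with the density at `x`, for weights that are small on
the cells away from `x`. -/
theorem abs_sum_mul_measureReal_cell_sub_le {μ : Measure ℝ} [IsProbabilityMeasure μ] {x G ε δ : ℝ}
    (hG : 0 ≤ G) (hδ : 0 < δ)
    (hμ : ∀ l r, |l - x| < δ → |r - x| < δ → l ≤ r → |μ.real (Ioc l r) - G * (r - l)| ≤ ε * (r - l))
    (hε : 0 ≤ ε) {m : ℕ} (hm : 4 / δ ≤ m) {q : ℕ → ℝ} (hq : ∀ k, 0 ≤ q k) {A : ℝ}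
    (hA : ∑ k ∈ farCells x δ m, q k ≤ A) :
    |m * ∑ k ∈ Finset.range m, q k * μ.real (cell m k) - G * ∑ k ∈ Finset.range m, q k| ≤
      ε * ∑ k ∈ Finset.range m, q k + (m + G) * A := by
  have hm0 : (0 : ℝ) < m := lt_of_lt_of_le (by positivity) hm
  have hmδ : 4 ≤ m * δ := (div_le_iff₀ hδ).1 hm
  -- In near cells both endpoints lie within `δ` of `x`, the right one because `1/m ≤ δ/4`. In far
  -- cells only the triangle inequality is used.
  have hterm : ∀ k ∈ Finset.range m, |q k * (m * μ.real (cell m k) - G)| ≤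
      ε * q k + (if δ / 2 ≤ |(k : ℝ) / m - x| then q k * (m * μ.real (cell m k) + G) else 0) := by
    intro k _
    rw [abs_mul, abs_of_nonneg (hq k)]
    split_ifs with h
    · have h1 : |m * μ.real (cell m k) - G| ≤ m * μ.real (cell m k) + G := by
        have : 0 ≤ m * μ.real (cell m k) := by positivity
        exact abs_le.2 ⟨by linarith, by linarith⟩
      have h2 := mul_le_mul_of_nonneg_left h1 (hq k)
      have h3 := mul_nonneg hε (hq k)
      linarith
    · push Not at h
      have h1 := hμ ((k : ℝ) / m) (((k : ℝ) + 1) / m) (by linarith) (by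
        have e : ((k : ℝ) + 1) / m - x = ((k : ℝ) / m - x) + 1 / m := by ring
        rw [e]
        refine (abs_add_le _ _).trans_lt ?_
        have h2 : |1 / (m : ℝ)| ≤ δ / 4 := by
          rw [abs_of_pos (by positivity), div_le_iff₀ hm0]
          linarith
        linarith) (by gcongr; linarith)
      have e1 : ((k : ℝ) + 1) / m - (k : ℝ) / m = 1 / m := by ring
      rw [e1] at h1
      have h3 : |m * μ.real (cell m k) - G| ≤ ε := by
        have e2 : m * μ.real (cell m k) - G = m * (μ.real (cell m k) - G * (1 / m)) := by
          field_simp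
        rw [e2, abs_mul, abs_of_pos hm0]
        calc (m : ℝ) * _ ≤ m * (ε * (1 / m)) := mul_le_mul_of_nonneg_left h1 hm0.le
          _ = ε := by field_simp
      have := mul_le_mul_of_nonneg_left h3 (hq k)
      linarith
  have e : m * ∑ k ∈ Finset.range m, q k * μ.real (cell m k) - G * ∑ k ∈ Finset.range m, q k =
      ∑ k ∈ Finset.range m, q k * (m * μ.real (cell m k) - G) := by
    rw [Finset.mul_sum, Finset.mul_sum, ← Finset.sum_sub_distrib]
    exact Finset.sum_congr rfl fun k _ => by ring
  rw [e]
  refine (Finset.abs_sum_le_sum_abs _ _).trans ((Finset.sum_le_sum hterm).trans ?_)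
  rw [Finset.sum_add_distrib, ← Finset.mul_sum, ← Finset.sum_filter]
  refine add_le_add_right ?_ _
  have hqA : ∀ k ∈ farCells x δ m, q k ≤ A := fun k hk =>
    (Finset.single_le_sum (fun i _ => hq i) hk).trans hA
  have hA0 : 0 ≤ A := (Finset.sum_nonneg fun k _ => hq k).trans hA
  calc ∑ k ∈ farCells x δ m, q k * (m * μ.real (cell m k) + G)
      = m * ∑ k ∈ farCells x δ m, q k * μ.real (cell m k) + G * ∑ k ∈ farCells x δ m, q k := by
        rw [Finset.mul_sum, Finset.mul_sum, ← Finset.sum_add_distrib]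
        exact Finset.sum_congr rfl fun k _ => by ring
    -- Each far weight is at most the far total `A`, and the disjoint cells have total mass at most
    -- `1`.
    _ ≤ m * ∑ k ∈ farCells x δ m, A * μ.real (cell m k) + G * A := by
        gcongr with k hk
        exact hqA k hk
    _ ≤ m * (A * 1) + G * A := by
        rw [← Finset.mul_sum]
        gcongr
        exact sum_measureReal_cell_le μ m _
    _ = _ := by ring

/-! ### Moments of the Bernstein kernel -/

/-- The contribution of an observation `y` to the Bernstein density estimator of order `m`. -/
noncomputable def bernsteinKernel (m : ℕ) (x y : ℝ) : ℝ :=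
  m * ∑ k ∈ Finset.range m,
    (bernsteinPolynomial ℝ (m - 1) k).eval x * (cell m k).indicator (fun _ => (1 : ℝ)) y

/-- The sum of the squared binomial weights. -/
noncomputable def bernsteinSqSum (m : ℕ) (x : ℝ) : ℝ :=
  ∑ k ∈ Finset.range m, (bernsteinPolynomial ℝ (m - 1) k).eval x ^ 2

theorem bernsteinSqSum_nonneg (m : ℕ) (x : ℝ) : 0 ≤ bernsteinSqSum m x :=
  Finset.sum_nonneg fun _ _ => sq_nonneg _

theorem measurable_bernsteinKernel (m : ℕ) (x : ℝ) : Measurable (bernsteinKernel m x) :=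
  (Finset.measurable_sum _ fun k _ =>
    (measurable_const.indicator (measurableSet_cell m k)).const_mul _).const_mul _

/-- An increment of the empirical distribution function over a cell is the proportion of
observations in it; exchanging the sums gives a sample average. -/
theorem bernsteinEstimator_eq (y : ℕ → ℝ) (m n : ℕ) (x : ℝ) :
    bernsteinEstimator y m n x = 1 / (n : ℝ) * ∑ j ∈ Finset.range n, bernsteinKernel m x (y j) := by
  have h : ∀ k : ℕ, ∀ u : ℝ, (Iic (((k : ℝ) + 1) / m)).indicator (fun _ => (1 : ℝ)) u -
      (Iic ((k : ℝ) / m)).indicator (fun _ => (1 : ℝ)) u =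
      (cell m k).indicator (fun _ => (1 : ℝ)) u := by
    intro k u
    have hle : (k : ℝ) / m ≤ ((k : ℝ) + 1) / m := by gcongr; linarith
    simp only [indicator_apply, mem_Iic, cell, mem_Ioc]
    by_cases h1 : u ≤ (k : ℝ) / m
    · simp [h1, h1.trans hle, not_lt.2 h1]
    · simp [h1, not_le.1 h1]
  simp only [bernsteinEstimator, empCDF, ← mul_sub, ← Finset.sum_sub_distrib, h, bernsteinKernel,
    Finset.mul_sum, Finset.sum_mul]
  rw [Finset.sum_comm]
  exact Finset.sum_congr rfl fun j _ => Finset.sum_congr rfl fun k _ => by ring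

/-- Cross terms vanish because the cells are disjoint. -/
theorem bernsteinKernel_sq (m : ℕ) (x y : ℝ) : bernsteinKernel m x y ^ 2 =
    m ^ 2 * ∑ k ∈ Finset.range m, (bernsteinPolynomial ℝ (m - 1) k).eval x ^ 2 *
      (cell m k).indicator (fun _ => (1 : ℝ)) y := by
  unfold bernsteinKernel
  rw [mul_pow, pow_two (∑ k ∈ _, _), Finset.sum_mul_sum]
  congr 1
  refine Finset.sum_congr rfl fun k hk => ?_
  rw [Finset.sum_eq_single k]
  · by_cases h : y ∈ cell m k
    · simp [h, pow_two]
    · simp [h]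
  · intro l _ hl
    by_cases h : y ∈ cell m k
    · simp [Set.disjoint_left.1 (cell_disjoint hl.symm) h]
    · simp [h]
  · exact fun h => absurd hk h

theorem bernsteinKernel_nonneg {x : ℝ} (hx : x ∈ Icc (0 : ℝ) 1) (m : ℕ) (y : ℝ) :
    0 ≤ bernsteinKernel m x y :=
  mul_nonneg (Nat.cast_nonneg m) (Finset.sum_nonneg fun _ _ =>
    mul_nonneg (bernstein_eval_nonneg hx _ _) (indicator_nonneg (fun _ _ => zero_le_one) _))

theorem bernsteinKernel_le (m : ℕ) (x y : ℝ) :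
    bernsteinKernel m x y ≤ m * √(bernsteinSqSum m x) := by
  refine (abs_le_of_sq_le_sq' ?_ (by positivity)).2
  rw [mul_pow, Real.sq_sqrt (bernsteinSqSum_nonneg m x), bernsteinKernel_sq, bernsteinSqSum]
  gcongr with k
  refine mul_le_of_le_one_right (sq_nonneg _) ?_
  exact indicator_le_self' (fun _ _ => zero_le_one) y

theorem integral_bernsteinKernel_nonneg {μ : Measure ℝ} {x : ℝ} (hx : x ∈ Icc (0 : ℝ) 1) (m : ℕ) :
    0 ≤ ∫ y, bernsteinKernel m x y ∂μ :=
  integral_nonneg fun y => bernsteinKernel_nonneg hx m y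

section Moments

variable (μ : Measure ℝ) [IsProbabilityMeasure μ]

theorem integral_sum_mul_indicator_cell (m : ℕ) (q : ℕ → ℝ) :
    ∫ y, ∑ k ∈ Finset.range m, q k * (cell m k).indicator (fun _ => (1 : ℝ)) y ∂μ =
      ∑ k ∈ Finset.range m, q k * μ.real (cell m k) := by
  rw [integral_finsetSum _ fun k _ =>
    ((integrable_const (1 : ℝ)).indicator (measurableSet_cell m k)).const_mul _]
  refine Finset.sum_congr rfl fun k _ => ?_
  rw [integral_const_mul, integral_indicator (measurableSet_cell m k)]
  simp

theorem integral_bernsteinKernel (m : ℕ) (x : ℝ) : ∫ y, bernsteinKernel m x y ∂μ =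
    m * ∑ k ∈ Finset.range m, (bernsteinPolynomial ℝ (m - 1) k).eval x * μ.real (cell m k) := by
  simp only [bernsteinKernel]
  rw [integral_const_mul, integral_sum_mul_indicator_cell]

theorem integral_bernsteinKernel_sq (m : ℕ) (x : ℝ) : ∫ y, bernsteinKernel m x y ^ 2 ∂μ =
    m ^ 2 * ∑ k ∈ Finset.range m,
      (bernsteinPolynomial ℝ (m - 1) k).eval x ^ 2 * μ.real (cell m k) := by
  simp only [bernsteinKernel_sq]
  rw [integral_const_mul, integral_sum_mul_indicator_cell]

variable {μ}

theorem integrable_bernsteinKernel {x : ℝ} (hx : x ∈ Icc (0 : ℝ) 1) (m : ℕ) :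
    Integrable (bernsteinKernel m x) μ :=
  Integrable.of_bound (measurable_bernsteinKernel m x).aestronglyMeasurable _
    (Eventually.of_forall fun y => by
      rw [Real.norm_of_nonneg (bernsteinKernel_nonneg hx m y)]
      exact bernsteinKernel_le m x y)

theorem integral_bernsteinKernel_le {x : ℝ} (hx : x ∈ Icc (0 : ℝ) 1) (m : ℕ) :
    ∫ y, bernsteinKernel m x y ∂μ ≤ m * √(bernsteinSqSum m x) := by
  refine (integral_mono (integrable_bernsteinKernel hx m) (integrable_const _)
    fun y => bernsteinKernel_le m x y).trans ?_
  simp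

variable {g : ℝ → ℝ}

/-- Boundedness of the mean suffices: its square is then negligible against the second moment after
scaling by `ρ m ^ 2`. -/
theorem exists_integral_bernsteinKernel_le
    (hμ : μ = volume.withDensity fun y => ENNReal.ofReal (g y)) (hg : Measurable g)
    (hg0 : ∀ y, 0 ≤ g y) {x : ℝ} (hx : x ∈ Icc (0 : ℝ) 1) (hgx : ContinuousAt g x) :
    ∃ K, ∀ᶠ m : ℕ in atTop, ∫ y, bernsteinKernel m x y ∂μ ≤ K := by
  obtain ⟨δ, hδ, hδμ⟩ := exists_abs_measureReal_Ioc_sub_le hg hg0 hgx one_pos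
  rw [← hμ] at hδμ
  refine ⟨g x + (1 + (1 + g x) * (16 / δ ^ 2)), ?_⟩
  have hev : ∀ᶠ m : ℕ in atTop, 4 / δ ≤ m :=
    tendsto_natCast_atTop_atTop.eventually_ge_atTop (4 / δ)
  filter_upwards [hev, eventually_gt_atTop 0] with m hm hm0
  have h := abs_sum_mul_measureReal_cell_sub_le (hg0 x) hδ hδμ zero_le_one hm
    (fun k => bernstein_eval_nonneg hx (m - 1) k) (sum_bernstein_far_le hx hδ hm)
  rw [sum_bernstein_eval hm0, ← integral_bernsteinKernel] at h
  have hm1 : (1 : ℝ) ≤ m := by exact_mod_cast hm0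
  have h2 : ((m : ℝ) + g x) * (16 / δ ^ 2 / m) ≤ (1 + g x) * (16 / δ ^ 2) := by
    have e : ((m : ℝ) + g x) * (16 / δ ^ 2 / m) = (1 + g x / m) * (16 / δ ^ 2) := by field_simp
    rw [e]
    gcongr
    exact div_le_self (hg0 x) hm1
  linarith [(abs_le.1 h).2]

/-- Asymptotics of the second moment of the Bernstein kernel. -/
theorem tendsto_mul_integral_bernsteinKernel_sq
    (hμ : μ = volume.withDensity fun y => ENNReal.ofReal (g y)) (hg : Measurable g)
    (hg0 : ∀ y, 0 ≤ g y) {x : ℝ} (hx : x ∈ Icc (0 : ℝ) 1) (hgx : ContinuousAt g x)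
    {ρ : ℕ → ℝ} (hρ : Tendsto ρ atTop (𝓝 0)) {τ : ℝ}
    (hτ : Tendsto (fun m : ℕ => m * ρ m ^ 2 * bernsteinSqSum m x) atTop (𝓝 τ)) :
    Tendsto (fun m : ℕ => ρ m ^ 2 * ∫ y, bernsteinKernel m x y ^ 2 ∂μ) atTop (𝓝 (g x * τ)) := by
  have hτm0 : ∀ m : ℕ, 0 ≤ m * ρ m ^ 2 * bernsteinSqSum m x := fun m =>
    mul_nonneg (by positivity) (bernsteinSqSum_nonneg m x)
  have hτ0 : 0 ≤ τ := ge_of_tendsto' hτ hτm0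
  have hdiff : Tendsto (fun m : ℕ => ρ m ^ 2 * ∫ y, bernsteinKernel m x y ^ 2 ∂μ -
      g x * (m * ρ m ^ 2 * bernsteinSqSum m x)) atTop (𝓝 0) := by
    rw [Metric.tendsto_nhds]
    intro η hη
    set ε := η / (2 * (τ + 1)) with hε
    have hε0 : 0 < ε := by positivity
    obtain ⟨δ, hδ, hδμ⟩ := exists_abs_measureReal_Ioc_sub_le hg hg0 hgx hε0
    rw [← hμ] at hδμ
    have hev : ∀ᶠ m : ℕ in atTop, 4 / δ ≤ m :=
      tendsto_natCast_atTop_atTop.eventually_ge_atTop (4 / δ)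
    have hsmall : Tendsto (fun m => ρ m ^ 2 * ((1 + g x) * (16 / δ ^ 2) ^ 2)) atTop (𝓝 0) := by
      simpa using (hρ.pow 2).mul_const ((1 + g x) * (16 / δ ^ 2) ^ 2)
    filter_upwards [hev, eventually_gt_atTop 0, hτ.eventually_lt_const (lt_add_one τ),
      hsmall.eventually_lt_const (half_pos hη)] with m hm hm0 hτm hsm
    have hm0' : (0 : ℝ) < m := by exact_mod_cast hm0
    have hm1 : (1 : ℝ) ≤ m := by exact_mod_cast hm0
    have hfar := sum_bernstein_far_le hx hδ hm
    -- Squaring the weights improves the Chebyshev rate from `1/m` to `1/m²`; the far contribution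
    -- is then of order `ρ m ^ 2` and tends to zero.
    have hfar2 : ∑ k ∈ farCells x δ m, (bernsteinPolynomial ℝ (m - 1) k).eval x ^ 2 ≤
        (16 / δ ^ 2 / m) ^ 2 := by
      have hp := fun k => bernstein_eval_nonneg hx (m - 1) k
      calc ∑ k ∈ farCells x δ m, (bernsteinPolynomial ℝ (m - 1) k).eval x ^ 2
          ≤ ∑ k ∈ farCells x δ m, (bernsteinPolynomial ℝ (m - 1) k).eval x * (16 / δ ^ 2 / m) := by
            refine Finset.sum_le_sum fun k hk => ?_
            rw [pow_two]
            exact mul_le_mul_of_nonneg_left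
              ((Finset.single_le_sum (fun i _ => hp i) hk).trans hfar) (hp k)
        _ ≤ _ := by
            rw [← Finset.sum_mul, pow_two (16 / δ ^ 2 / (m : ℝ))]
            exact mul_le_mul_of_nonneg_right hfar (by positivity)
    have h := abs_sum_mul_measureReal_cell_sub_le (hg0 x) hδ hδμ hε0.le hm
      (q := fun k => (bernsteinPolynomial ℝ (m - 1) k).eval x ^ 2) (fun k => sq_nonneg _) hfar2
    change |_ - g x * bernsteinSqSum m x| ≤ ε * bernsteinSqSum m x + _ at h
    rw [Real.dist_eq, sub_zero, integral_bernsteinKernel_sq]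
    have e : ρ m ^ 2 * (m ^ 2 * ∑ k ∈ Finset.range m,
        (bernsteinPolynomial ℝ (m - 1) k).eval x ^ 2 * μ.real (cell m k)) -
        g x * (m * ρ m ^ 2 * bernsteinSqSum m x) =
        (m * ρ m ^ 2) * (m * ∑ k ∈ Finset.range m,
          (bernsteinPolynomial ℝ (m - 1) k).eval x ^ 2 * μ.real (cell m k) -
          g x * bernsteinSqSum m x) := by ring
    rw [e, abs_mul, abs_of_nonneg (by positivity : 0 ≤ (m : ℝ) * ρ m ^ 2)]
    have h1 : (m : ℝ) * ρ m ^ 2 * (((m : ℝ) + g x) * (16 / δ ^ 2 / m) ^ 2) ≤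
        ρ m ^ 2 * ((1 + g x) * (16 / δ ^ 2) ^ 2) := by
      have e : (m : ℝ) * ρ m ^ 2 * (((m : ℝ) + g x) * (16 / δ ^ 2 / m) ^ 2) =
          ρ m ^ 2 * ((1 + g x / m) * (16 / δ ^ 2) ^ 2) := by field_simp
      rw [e]
      gcongr
      exact div_le_self (hg0 x) hm1
    have h2 : ε * (m * ρ m ^ 2 * bernsteinSqSum m x) ≤ η / 2 := by
      calc ε * (m * ρ m ^ 2 * bernsteinSqSum m x) ≤ ε * (τ + 1) := by gcongr
        _ = η / 2 := by rw [hε]; field_simp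
    calc (m : ℝ) * ρ m ^ 2 * _ ≤ m * ρ m ^ 2 * (ε * bernsteinSqSum m x +
          ((m : ℝ) + g x) * (16 / δ ^ 2 / m) ^ 2) := mul_le_mul_of_nonneg_left h (by positivity)
      _ = ε * (m * ρ m ^ 2 * bernsteinSqSum m x) +
          m * ρ m ^ 2 * (((m : ℝ) + g x) * (16 / δ ^ 2 / m) ^ 2) := by ring
      _ < η := by linarith
  simpa using hdiff.add (hτ.const_mul (g x))

theorem tendsto_mul_variance_bernsteinKernel
    (hμ : μ = volume.withDensity fun y => ENNReal.ofReal (g y)) (hg : Measurable g)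
    (hg0 : ∀ y, 0 ≤ g y) {x : ℝ} (hx : x ∈ Icc (0 : ℝ) 1) (hgx : ContinuousAt g x)
    {ρ : ℕ → ℝ} (hρ : Tendsto ρ atTop (𝓝 0)) {τ : ℝ}
    (hτ : Tendsto (fun m : ℕ => m * ρ m ^ 2 * bernsteinSqSum m x) atTop (𝓝 τ)) :
    Tendsto (fun m : ℕ => ρ m ^ 2 *
      ∫ y, (bernsteinKernel m x y - ∫ z, bernsteinKernel m x z ∂μ) ^ 2 ∂μ) atTop
      (𝓝 (g x * τ)) := by
  obtain ⟨K, hK⟩ := exists_integral_bernsteinKernel_le hμ hg hg0 hx hgx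
  have h1 := tendsto_mul_integral_bernsteinKernel_sq hμ hg hg0 hx hgx hρ hτ
  have h2 : Tendsto (fun m => ρ m ^ 2 * (∫ y, bernsteinKernel m x y ∂μ) ^ 2) atTop (𝓝 0) := by
    have h3 : Tendsto (fun m => ρ m ^ 2 * K ^ 2) atTop (𝓝 0) := by
      simpa using (hρ.pow 2).mul_const (K ^ 2)
    refine squeeze_zero' (Eventually.of_forall fun m => by positivity) ?_ h3
    filter_upwards [hK] with m hm
    have := integral_bernsteinKernel_nonneg (μ := μ) hx m
    gcongr
  have h3 := h1.sub h2
  rw [sub_zero] at h3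
  refine h3.congr fun m => ?_
  have hm : MemLp (bernsteinKernel m x) 2 μ :=
    MemLp.of_bound (measurable_bernsteinKernel m x).aestronglyMeasurable
      (m * √(bernsteinSqSum m x)) (Eventually.of_forall fun y => by
        rw [Real.norm_of_nonneg (bernsteinKernel_nonneg hx m y)]
        exact bernsteinKernel_le m x y)
  rw [← variance_eq_integral hm.1.aemeasurable, variance_eq_sub hm, mul_sub]
  rfl

end Moments

/-! ### Asymptotic normality and the two normalizations -/

/-- Asymptotic normality of the Bernstein density estimator of an i.i.d. sample at a point where the
density is continuous. -/
theorem tendstoInDistribution_bernsteinEstimator {Ω : Type*} [MeasurableSpace Ω] {P : Measure Ω}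
    [IsProbabilityMeasure P] {Y : ℕ → Ω → ℝ} (hindep : iIndepFun Y P)
    (hident : ∀ j, IdentDistrib (Y j) (Y 0) P P) {g : ℝ → ℝ} (hg : IsDensity P (Y 0) g) {x : ℝ}
    (hx : x ∈ Icc (0 : ℝ) 1) (hgx : ContinuousAt g x) {m : ℕ → ℕ} (hm : Tendsto m atTop atTop)
    (hmn : Tendsto (fun n => (m n : ℝ) / n) atTop (𝓝 0)) {ρ : ℕ → ℝ}
    (hρ : Tendsto ρ atTop (𝓝 0)) {τ : ℝ}
    (hτ : Tendsto (fun m : ℕ => m * ρ m ^ 2 * bernsteinSqSum m x) atTop (𝓝 τ)) :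
    TendstoInDistribution
      (fun (n : ℕ) ω => (n : ℝ) ^ (1 / 2 : ℝ) * ρ (m n) *
        (bernsteinEstimator (fun j => Y j ω) (m n) n x -
          ∫ ω', bernsteinEstimator (fun j => Y j ω') (m n) n x ∂P))
      atTop (id : ℝ → ℝ) (fun _ => P) (gaussianReal 0 (g x * τ).toNNReal) := by
  obtain ⟨hYm, hgm, hg0, hlaw⟩ := hg
  set μ := P.map (Y 0) with hμ
  have hprob : IsProbabilityMeasure μ := Measure.isProbabilityMeasure_map hYm
  have hYmj : ∀ j, AEMeasurable (Y j) P := fun j => (hident j).aemeasurable_fst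
  let E : ℕ → ℝ := fun m => ∫ y, bernsteinKernel m x y ∂μ
  let c : ℕ → ℝ := fun n => (n : ℝ) ^ (1 / 2 : ℝ) * ρ (m n) * (1 / (n : ℝ))
  have hc2 : ∀ n, c n ^ 2 = ρ (m n) ^ 2 / n := fun n => by
    rcases Nat.eq_zero_or_pos n with rfl | hn
    · simp [c]
    · have hn' : (0 : ℝ) < n := by exact_mod_cast hn
      have : ((n : ℝ) ^ (1 / 2 : ℝ)) ^ 2 = n := by
        rw [← Real.sqrt_eq_rpow, Real.sq_sqrt hn'.le]
      simp only [c, mul_pow, this]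
      field_simp
  have hτ0 : 0 ≤ τ := ge_of_tendsto' hτ fun m =>
    mul_nonneg (by positivity) (bernsteinSqSum_nonneg m x)
  -- The factor `1/n · n` is not simplified, so that the identity also covers `n = 0`.
  have hmean : ∀ n, ∫ ω', bernsteinEstimator (fun j => Y j ω') (m n) n x ∂P =
      1 / (n : ℝ) * (n * E (m n)) := fun n => by
    simp only [bernsteinEstimator_eq]
    have hint : ∀ j, Integrable (fun ω => bernsteinKernel (m n) x (Y j ω)) P := fun j =>
      Integrable.of_bound
        ((measurable_bernsteinKernel (m n) x).comp_aemeasurable (hYmj j)).aestronglyMeasurable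
        (m n * √(bernsteinSqSum (m n) x)) (Eventually.of_forall fun ω => by
          rw [Real.norm_of_nonneg (bernsteinKernel_nonneg hx _ _)]
          exact bernsteinKernel_le _ _ _)
    have hj : ∀ j, ∫ ω, bernsteinKernel (m n) x (Y j ω) ∂P = E (m n) := fun j => by
      simp only [E]
      rw [hμ, ← (hident j).map_eq, integral_map (hYmj j)
        (measurable_bernsteinKernel (m n) x).aestronglyMeasurable]
    rw [integral_const_mul, integral_finsetSum _ fun j _ => hint j]
    simp [hj]
  have hmain := tendstoInDistribution_triangular hindep hident
    (ζ := fun n y => c n * (bernsteinKernel (m n) x y - E (m n)))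
    -- This is `|c n|` times the bound `m √(∑ p_k²)` on the kernel, rearranged into a factor `m/n →
    -- 0` and one converging to `τ`.
    (B := fun n => √((m n : ℝ) / n * ((m n) * ρ (m n) ^ 2 * bernsteinSqSum (m n) x)))
    (v := g x * τ)
    (fun n => ((measurable_bernsteinKernel (m n) x).sub_const _).const_mul _)
    (fun n y => by
      refine Real.abs_le_sqrt ?_
      have h1 : |bernsteinKernel (m n) x y - E (m n)| ≤ m n * √(bernsteinSqSum (m n) x) := by
        have a1 := bernsteinKernel_nonneg hx (m n) y
        have a2 := bernsteinKernel_le (m n) x y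
        have a3 : 0 ≤ E (m n) := integral_bernsteinKernel_nonneg hx (m n)
        have a4 : E (m n) ≤ _ := integral_bernsteinKernel_le hx (m n)
        exact abs_le.2 ⟨by linarith, by linarith⟩
      have h2 := pow_le_pow_left₀ (abs_nonneg _) h1 2
      rw [sq_abs, mul_pow, Real.sq_sqrt (bernsteinSqSum_nonneg _ x)] at h2
      rw [mul_pow, hc2]
      calc ρ (m n) ^ 2 / n * _ ≤ ρ (m n) ^ 2 / n * ((m n : ℝ) ^ 2 * bernsteinSqSum (m n) x) :=
            mul_le_mul_of_nonneg_left h2 (by positivity)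
        _ = _ := by ring)
    (by
      have := (hmn.mul (hτ.comp hm)).sqrt
      simpa using this)
    (fun n => by
      rw [integral_const_mul, integral_sub (integrable_bernsteinKernel hx _) (integrable_const _)]
      simp [E, hμ])
    (mul_nonneg (hg0 x) hτ0)
    (by
      have h := (tendsto_mul_variance_bernsteinKernel hlaw hgm hg0 hx hgx hρ hτ).comp hm
      refine h.congr' ?_
      filter_upwards [eventually_gt_atTop 0] with n hn
      have hn' : (n : ℝ) ≠ 0 := by exact_mod_cast hn.ne'
      simp only [Function.comp_apply, mul_pow, hc2]
      rw [integral_const_mul]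
      field_simp
      rfl)
  refine cast (congrArg (fun F : ℕ → Ω → ℝ => TendstoInDistribution F atTop (id : ℝ → ℝ)
    (fun _ => P) (gaussianReal 0 (g x * τ).toNNReal)) ?_) hmain
  ext n ω
  rw [hmean, bernsteinEstimator_eq, ← Finset.mul_sum, Finset.sum_sub_distrib]
  simp only [c, Finset.sum_const, Finset.card_range, nsmul_eq_mul]
  ring

theorem tendsto_mul_rpow_sq_mul_bernsteinSqSum {x : ℝ} (hx : x ∈ Ioo (0 : ℝ) 1) :
    Tendsto (fun m : ℕ => m * ((m : ℝ) ^ (-(1 / 4) : ℝ)) ^ 2 * bernsteinSqSum m x) atTop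
      (𝓝 (psi x)) := by
  -- Order `m` uses weights of degree `m - 1`: with `m = N + 1` the local limit has factor `√N`, and
  -- `√((N+1)/N) → 1` corrects it.
  rw [← tendsto_add_atTop_iff_nat 1]
  have h1 : Tendsto (fun N : ℕ => √(((N : ℝ) + 1) / N)) atTop (𝓝 1) := by
    have : Tendsto (fun N : ℕ => 1 + 1 / (N : ℝ)) atTop (𝓝 (1 + 0)) :=
      tendsto_const_nhds.add tendsto_one_div_atTop_nhds_zero_nat
    rw [add_zero] at this
    have h := this.sqrt
    rw [Real.sqrt_one] at h
    refine h.congr' ?_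
    filter_upwards [eventually_gt_atTop 0] with N hN
    have : (N : ℝ) ≠ 0 := by exact_mod_cast hN.ne'
    congr 1
    field_simp
  have h2 := h1.mul (tendsto_sqrt_mul_sum_sq_bernstein hx)
  rw [one_mul] at h2
  refine h2.congr' ?_
  filter_upwards [eventually_gt_atTop 0] with N hN
  have hN' : (0 : ℝ) < N := by exact_mod_cast hN
  simp only [bernsteinSqSum, Nat.add_sub_cancel]
  rw [← mul_assoc, ← Real.sqrt_mul (by positivity), div_mul_cancel₀ _ hN'.ne']
  congr 1
  push_cast
  rw [← Real.rpow_natCast, ← Real.rpow_mul (by positivity), Real.sqrt_eq_rpow]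
  nth_rewrite 2 [← Real.rpow_one ((N : ℝ) + 1)]
  rw [← Real.rpow_add (by positivity)]
  norm_num

/-- At an endpoint the binomial law is a point mass, at `k = 0` or `k = m - 1`. -/
theorem bernsteinSqSum_eq_one {x : ℝ} (hx : x ∈ ({0, 1} : Set ℝ)) {m : ℕ} (hm : 0 < m) :
    bernsteinSqSum m x = 1 := by
  unfold bernsteinSqSum
  rcases hx with rfl | rfl
  · rw [Finset.sum_eq_single 0] <;> simp +contextual [bernsteinPolynomial.eval_at_0, hm.ne']
  · rw [Finset.sum_eq_single (m - 1)] <;>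
      simp +contextual [bernsteinPolynomial.eval_at_1, hm]

theorem tendsto_natCast_rpow_neg {r : ℝ} (hr : 0 < r) :
    Tendsto (fun m : ℕ => (m : ℝ) ^ (-r)) atTop (𝓝 0) :=
  (tendsto_rpow_neg_atTop hr).comp tendsto_natCast_atTop_atTop

end FracRE

open FracRE in
theorem theorem1 {Ω : Type*} [MeasurableSpace Ω] (P : Measure Ω) [IsProbabilityMeasure P]
    -- the model
    (H : ℝ) (hH : H ∈ Ioo (1 / 2 : ℝ) 1) (T : ℝ) (hT : 0 < T) (x₀ : ℝ)
    (a b σ : ℝ → ℝ) (ha : Measurable a) (hb : Measurable b) (hσ : Measurable σ)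
    (hσ_pos : ∀ t, 0 ≤ t → 0 < σ t)
    (W : ℕ → ℝ → Ω → ℝ) (hW : ∀ j, IsFBM P H (W j))
    (hW_indep : iIndepFun (fun j ω (t : ℝ≥0) => W j t ω) P)
    (φ : ℕ → Ω → ℝ) (hφ : ∀ j, Measurable (φ j)) (hφ_indep : iIndepFun φ P)
    (f : ℝ → ℝ) (hφ_density : ∀ j, IsDensity P (φ j) f)
    (hf_supp : ∀ y, y ∉ Icc (0 : ℝ) 1 → f y = 0)
    (hφW : IndepFun (fun ω j => φ j ω) (fun ω j (t : ℝ≥0) => W j t ω) P)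
    (X : ℕ → ℝ → Ω → ℝ) (hX : ∀ j, IsSolution P H a b σ x₀ (φ j) (W j) (X j))
    -- `J₂` and `J₁` are well defined, and `J₁` is square integrable for `dw`
    (hJ₂ : HasJ H (fun s => b s / σ s))
    (hJ₁ : ∀ j, ∀ᵐ ω ∂P, HasJ H (fun s => a (X j s ω) / σ s) ∧
      ∀ S, 0 < S → IntegrableOn (fun t => J₁ H a σ (fun s => X j s ω) t ^ 2) (Ioc 0 S) (dw H))
    -- `Z j t = ∫_0^t k_H(t, s) / σ(s) dX^j_s`
    (Z : ℕ → ℝ → Ω → ℝ)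
    (hZ : ∀ j, ∀ t ∈ Icc 0 T, IsDiffusionIntegral P H a b σ (φ j) (W j) (X j)
      (fun s => kernel H t s / σ s) t (Z j t))
    -- `I j = ∫_0^T J₂ dZ^j`, and `Y j` is the estimator of the random effect `φ j`
    (I : ℕ → Ω → ℝ) (hI : ∀ j, IsSemimartingaleIntegral P H (Z j) (J₂ H b σ) T (I j))
    (Y : ℕ → Ω → ℝ) (hY : ∀ j ω, Y j ω = phiHat H a b σ T (fun t => X j t ω) (I j ω))
    -- (A1), (A2), (A3)
    (hA1 : ∀ S, 0 < S → IntegrableOn (fun t => J₂ H b σ t ^ 2) (Ioc 0 S) (dw H))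
    (hA2 : Tendsto (fun S => ∫ t in Ioc 0 S, J₂ H b σ t ^ 2 ∂(dw H)) atTop atTop)
    (hA3 : ContDiffOn ℝ 2 f (Icc 0 1))
    -- (A4)
    (x : ℝ) (g : ℝ → ℝ) (hg_density : IsDensity P (Y 0) g) (hg_pos : ∀ y, 0 < g y)
    (hg_cont : ContinuousAt g x)
    -- the order of the Bernstein polynomials
    (m : ℕ → ℕ) (hm : Tendsto m atTop atTop)
    (hmn : Tendsto (fun n => (m n : ℝ) / n) atTop (𝓝 0)) :
    (x ∈ Ioo (0 : ℝ) 1 →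
      TendstoInDistribution
        (fun (n : ℕ) ω => (n : ℝ) ^ (1 / 2 : ℝ) * (m n : ℝ) ^ (-(1 / 4) : ℝ) *
          (bernsteinEstimator (fun j => Y j ω) (m n) n x -
            ∫ ω', bernsteinEstimator (fun j => Y j ω') (m n) n x ∂P))
        atTop (id : ℝ → ℝ) (fun _ => P) (gaussianReal 0 (g x * psi x).toNNReal)) ∧
    (x ∈ ({0, 1} : Set ℝ) →
      TendstoInDistribution
        (fun (n : ℕ) ω => (n : ℝ) ^ (1 / 2 : ℝ) * (m n : ℝ) ^ (-(1 / 2) : ℝ) *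
          (bernsteinEstimator (fun j => Y j ω) (m n) n x -
            ∫ ω', bernsteinEstimator (fun j => Y j ω') (m n) n x ∂P))
        atTop (id : ℝ → ℝ) (fun _ => P) (gaussianReal 0 (g x).toNNReal)) := by
  obtain ⟨hindep, hident⟩ := phiHat_iid hH hT hW hW_indep hφ hφ_indep
    (fun j => by rw [(hφ_density j).2.2.2, (hφ_density 0).2.2.2]) hφW hJ₂ hJ₁ hZ hI hA1 hY
  refine ⟨fun hx => ?_, fun hx => ?_⟩
  · exact tendstoInDistribution_bernsteinEstimator hindep hident hg_density
      (Ioo_subset_Icc_self hx) hg_cont hm hmn (ρ := fun m => (m : ℝ) ^ (-(1 / 4) : ℝ))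
      (tendsto_natCast_rpow_neg (by norm_num)) (tendsto_mul_rpow_sq_mul_bernsteinSqSum hx)
  · have hx' : x ∈ Icc (0 : ℝ) 1 := by rcases hx with rfl | rfl <;> simp
    have h := tendstoInDistribution_bernsteinEstimator hindep hident hg_density hx' hg_cont hm hmn
      (ρ := fun m => (m : ℝ) ^ (-(1 / 2) : ℝ)) (τ := 1)
      (tendsto_natCast_rpow_neg (by norm_num)) (by
        refine tendsto_const_nhds.congr' ?_
        filter_upwards [eventually_gt_atTop 0] with k hk
        have hk' : (0 : ℝ) < k := by exact_mod_cast hk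
        rw [bernsteinSqSum_eq_one hx hk, Real.rpow_neg hk'.le, ← Real.sqrt_eq_rpow, inv_pow,
          Real.sq_sqrt hk'.le]
        field_simp)
    rwa [mul_one] at h
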